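/- Let $\mathbb{C}_+=\{z\in\mathbb{C}:\operatorname{Re}z>0\}$. Let $A^1_+(\mathbb{C}_+)$ be the space of Laplace transforms $(\mathcal{L}\mu)(z)=\int_{[0,\infty)}e^{-sz}\,\mu(ds)$, $z\in\mathbb{C}_+$, of bounded complex Radon measures $\mu$ on $[0,\infty)$, with norm $\|\mathcal{L}\mu\|_{A^1_+(\mathbb{C}_+)}=|\mu|([0,\infty))$, the total variation of $\mu$ (which is uniquely determined by $\mathcal{L}\mu$). A function $f\in C^\infty(0,\infty)$ is completely monotone if $(-1)^n f^{(n)}(x)\ge 0$ for all integers $n\ge 0$ and all $x>0$. A Bernstein function is a nonnegative $\varphi\in C^\infty(0,\infty)$ whose derivative is completely monotone. Let $\Phi$ be the set of all Bernstein functions $\varphi$ such that $\varphi(0+)=0$, $\varphi'(0+)=1$ and the limit $\varphi''(0+)$ is finite. Proposition 4.4. Let $\varphi\in\Phi$. Then $\varphi$ has a (necessarily unique) extension, again denoted by $\varphi$, to a continuous function on $\{\operatorname{Re}z\ge 0\}$ that is holomorphic in $\mathbb{C}_+$. For every $t>0$ the function $z\mapsto z^{-2}\bigl(e^{-t\varphi(z)}-e^{-tz}\bigr)$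 is completely monotone on $(0,\infty)$ and, as a function on $\mathbb{C}_+$, belongs to $A^1_+(\mathbb{C}_+)$, and $$\bigl\|z^{-2}\bigl(e^{-t\varphi(z)}-e^{-tz}\bigr)\bigr\|_{A^1_+(\mathbb{C}_+)}=\frac t2\,|\varphi''(0+)|.$$ -/

import Mathlib

open MeasureTheory Filter Topology Set
open scoped NNReal ENNReal BoundedContinuousFunction ContDiff

namespace HillePhillips

/-- A complex measure has finite total variation. -/
instance isFiniteMeasure_variation {X : Type*} [MeasurableSpace X] (μ : ComplexMeasure X) :
    IsFiniteMeasure μ.variation := by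
  have h : μ.variation ≤ (ComplexMeasure.re μ).totalVariation +
      (ComplexMeasure.im μ).totalVariation := by
    apply VectorMeasure.variation_le_of_forall_enorm_le
    intro E _
    have h1 := SignedMeasure.enorm_le_totalVariation (ComplexMeasure.re μ) E
    have h2 := SignedMeasure.enorm_le_totalVariation (ComplexMeasure.im μ) E
    calc ‖μ E‖ₑ ≤ ‖(μ E).re‖ₑ + ‖(μ E).im‖ₑ := by
          simp only [← ofReal_norm]
          rw [← ENNReal.ofReal_add (norm_nonneg _) (norm_nonneg _)]
          exact ENNReal.ofReal_le_ofReal (by simpa using Complex.norm_le_abs_re_add_abs_im (μ E))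
      _ ≤ _ := by
          rw [Measure.add_apply]
          exact add_le_add h1 h2
  exact isFiniteMeasure_of_le _ h

/-- The Laplace transform `∫ e^{-sz} μ(ds)` of a complex Borel measure `μ` on `[0, ∞)`. -/
noncomputable def laplaceTransform (μ : ComplexMeasure ℝ≥0) (z : ℂ) : ℂ :=
  μ.integral (fun s : ℝ≥0 => Complex.exp (-((s : ℝ) : ℂ) * z)) (ContinuousLinearMap.mul ℝ ℂ)

/-- Integrals of real functions against a real-linear image of a complex measure. Only used to
show that the Laplace transform is injective. -/
theorem map_integral {X : Type*} [MeasurableSpace X] (μ : ComplexMeasure X)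
    (L : ℂ →L[ℝ] ℝ) (P N : Measure X) [IsFiniteMeasure P] [IsFiniteMeasure N] (c : ℝ≥0)
    (hPc : P ≤ c • μ.variation) (hNc : N ≤ c • μ.variation)
    (h : ∀ s, MeasurableSet s → L (μ s) = P.real s - N.real s)
    {f : X → ℝ} (hf : Integrable f μ.variation) :
    L (μ.integral (fun x => (f x : ℂ)) (ContinuousLinearMap.mul ℝ ℂ)) =
      ∫ x, f x ∂P - ∫ x, f x ∂N := by
  have hi : ∀ g : X → ℝ, Integrable g μ.variation → ∀ Q : Measure X, Q ≤ c • μ.variation →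
      Integrable g Q := fun g hg Q hQ => (hg.smul_measure_nnreal (c := c)).mono_measure hQ
  have hic : ∀ g : X → ℝ, Integrable g μ.variation →
    Integrable (fun x => (g x : ℂ)) μ.variation := fun g hg => hg.ofReal
  have hQ : ∀ Q : Measure X, Q ≤ c • μ.variation →
      Continuous (fun f : X →₁[μ.variation] ℝ => ∫ x, f x ∂Q) := by
    intro Q hQ
    rw [continuous_iff_continuousAt]
    intro f
    refine tendsto_integral_of_L1 _ (hi _ (L1.integrable_coeFn f) Q hQ).1
      (Eventually.of_forall fun g => hi _ (L1.integrable_coeFn g) Q hQ) ?_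
    have h0 : Tendsto (fun g : X →₁[μ.variation] ℝ => (c : ℝ≥0∞) * edist g f) (𝓝 f) (𝓝 0) := by
      have := (tendsto_iff_edist_tendsto_0.1 (tendsto_id (x := 𝓝 f)))
      simpa using ENNReal.Tendsto.const_mul this (Or.inr ENNReal.coe_ne_top)
    refine tendsto_of_tendsto_of_tendsto_of_le_of_le tendsto_const_nhds h0 (fun _ => zero_le) ?_
    intro g
    calc ∫⁻ x, ‖g x - f x‖ₑ ∂Q ≤ ∫⁻ x, ‖g x - f x‖ₑ ∂(c • μ.variation) := lintegral_mono' hQ le_rfl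
      _ = c * edist g f := by
        rw [lintegral_smul_measure, L1.edist_def]
        rfl
  refine Integrable.induction (μ := μ.variation) (P := fun f : X → ℝ =>
    L (μ.integral (fun x => (f x : ℂ)) (ContinuousLinearMap.mul ℝ ℂ)) =
      ∫ x, f x ∂P - ∫ x, f x ∂N) ?_ ?_ ?_ ?_ hf
  · intro a s hs hfin
    have e1 : (fun x => ((s.indicator (fun _ => a) x : ℝ) : ℂ)) =
        s.indicator (fun _ => (a : ℂ)) := by
      ext x
      by_cases hx : x ∈ s <;> simp [hx]
    rw [e1, integral_indicator_const _ hs, integral_indicator_const _ hs, VectorMeasure.integral,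
      setToFun_indicator_const _ hs hfin.ne]
    have e2 : (μ.transpose (ContinuousLinearMap.mul ℝ ℂ)) s (a : ℂ) = a • μ s := by
      simp [VectorMeasure.transpose, VectorMeasure.mapRange_apply, mul_comm]
    rw [e2, map_smul, h s hs]
    simp only [smul_eq_mul]
    ring
  · intro f g _ hf hg h1 h2
    simp only [Pi.add_apply, Complex.ofReal_add]
    rw [VectorMeasure.integral_fun_add (hic f hf) (hic g hg), map_add, h1, h2,
      integral_add (hi f hf P hPc) (hi g hg P hPc), integral_add (hi f hf N hNc) (hi g hg N hNc)]
    ring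
  · refine isClosed_eq (L.continuous.comp ?_) ((hQ P hPc).sub (hQ N hNc))
    rw [continuous_iff_continuousAt]
    intro f
    refine VectorMeasure.tendsto_integral_of_L1 _ (hic _ (L1.integrable_coeFn f)).1
      (Eventually.of_forall fun g => hic _ (L1.integrable_coeFn g)) ?_
    have := (tendsto_iff_edist_tendsto_0.1 (tendsto_id (x := 𝓝 f)))
    refine this.congr fun g => ?_
    rw [L1.edist_def]
    refine lintegral_congr fun x => ?_
    simp only [id]
    rw [← Complex.ofReal_sub, edist_eq_enorm_sub, ← ofReal_norm, ← ofReal_norm, Complex.norm_real]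
  · intro f g hfg hf h1
    have e : ∀ Q : Measure X, Q ≤ c • μ.variation → ∫ x, f x ∂Q = ∫ x, g x ∂Q := fun Q hQ =>
      integral_congr_ae ((Measure.absolutelyContinuous_of_le hQ).trans
        Measure.smul_absolutelyContinuous |>.ae_le hfg)
    rw [← e P hPc, ← e N hNc, ← h1]
    congr 1
    refine VectorMeasure.integral_congr_ae ?_
    filter_upwards [hfg] with x hx
    rw [hx]

/-- A finite positive measure on `[0, ∞)` is determined by its exponential moments. -/
theorem eq_of_exp (P N : Measure ℝ≥0) [IsFiniteMeasure P] [IsFiniteMeasure N]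
    (h : ∀ n : ℕ, ∫ s : ℝ≥0, Real.exp (-(s : ℝ)) ^ n ∂P = ∫ s : ℝ≥0, Real.exp (-(s : ℝ)) ^ n ∂N) :
    P = N := by
  let e : ℝ≥0 →ᵇ ℝ := BoundedContinuousFunction.ofNormedAddCommGroup
    (fun s : ℝ≥0 => Real.exp (-(s : ℝ))) (by fun_prop) 1 (fun s => by
      rw [Real.norm_eq_abs, abs_of_pos (Real.exp_pos _)]
      exact Real.exp_le_one_iff.2 (by simp))
  let A : StarSubalgebra ℝ (ℝ≥0 →ᵇ ℝ) :=
    { Algebra.adjoin ℝ {e} with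
      star_mem' := fun {a} ha => by
        have h1 : star a = a := by
          ext x
          simp
        rw [h1]
        exact ha }
  have heA : e ∈ A := Algebra.subset_adjoin (mem_singleton e)
  refine ext_of_forall_mem_subalgebra_integral_eq_of_pseudoEMetric_complete_countable
    (A := A) ?_ ?_
  · intro x y hxy
    refine ⟨e, ⟨_, ⟨e, heA, rfl⟩, rfl⟩, ?_⟩
    change Real.exp (-(x : ℝ)) ≠ Real.exp (-(y : ℝ))
    intro h
    exact hxy (NNReal.coe_injective (neg_injective (Real.exp_injective h)))
  · intro g hg
    have hg' : g ∈ Algebra.adjoin ℝ {e} := hg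
    rw [Algebra.adjoin_singleton_eq_range_aeval] at hg'
    obtain ⟨p, rfl⟩ := hg'
    have key : ∀ x : ℝ≥0, (Polynomial.aeval e p : ℝ≥0 →ᵇ ℝ) x =
        ∑ i ∈ Finset.range (p.natDegree + 1), p.coeff i * Real.exp (-(x : ℝ)) ^ i := by
      intro x
      rw [Polynomial.aeval_eq_sum_range]
      simp [e]
    have hint : ∀ (Q : Measure ℝ≥0) [IsFiniteMeasure Q] (i : ℕ),
        Integrable (fun x : ℝ≥0 => Real.exp (-(x : ℝ)) ^ i) Q := fun Q _ i =>
      (e ^ i).integrable Q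
    simp only [AlgHom.toRingHom_eq_coe, RingHom.coe_coe, key]
    rw [integral_finsetSum _ fun i _ => (hint P i).const_mul _,
      integral_finsetSum _ fun i _ => (hint N i).const_mul _]
    refine Finset.sum_congr rfl fun i _ => ?_
    rw [integral_const_mul, integral_const_mul, h i]

theorem kernel_integrable (μ : ComplexMeasure ℝ≥0) {z : ℂ} (hz : 0 ≤ z.re) :
    Integrable (fun s : ℝ≥0 => Complex.exp (-((s : ℝ) : ℂ) * z)) μ.variation := by
  refine Integrable.of_bound (by fun_prop) 1 (Eventually.of_forall fun s => ?_)
  rw [Complex.norm_exp]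
  simp
  positivity

/-- The Laplace transform is injective on complex measures on `[0, ∞)`. -/
theorem laplaceTransform_injective {μ ν : ComplexMeasure ℝ≥0}
    (h : ∀ z : ℂ, 0 < z.re → laplaceTransform μ z = laplaceTransform ν z) : μ = ν := by
  rw [← sub_eq_zero]
  set m := μ - ν with hm
  have h1 : ∀ z : ℂ, 0 < z.re → laplaceTransform m z = 0 := by
    intro z hz
    have := h z hz
    unfold laplaceTransform at this ⊢
    rw [hm, VectorMeasure.integral_sub_vectorMeasure (kernel_integrable μ hz.le)
      (kernel_integrable ν hz.le), this, sub_self]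
  have h0 : laplaceTransform m 0 = 0 := by
    have ht : Tendsto (fun n : ℕ => laplaceTransform m ((1 / ((n : ℝ) + 1) : ℝ) : ℂ)) atTop
        (𝓝 (laplaceTransform m 0)) := by
      refine VectorMeasure.tendsto_integral_of_dominated_convergence (fun _ => 1)
        (fun n => by fun_prop) (integrable_const _)
        (fun n => Eventually.of_forall fun s => ?_) (Eventually.of_forall fun s => ?_)
      · rw [Complex.norm_exp, Real.exp_le_one_iff, ← Complex.ofReal_neg, ← Complex.ofReal_mul,
          Complex.ofReal_re, neg_mul, neg_nonpos]
        positivity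
      · have : Continuous fun x : ℝ => Complex.exp (-((s : ℝ) : ℂ) * (x : ℂ)) := by fun_prop
        have h2 := (this.tendsto 0).comp (tendsto_one_div_add_atTop_nhds_zero_nat (𝕜 := ℝ))
        simpa [Function.comp_def] using h2
    refine tendsto_nhds_unique ht ?_
    refine tendsto_const_nhds.congr fun n => (h1 _ ?_).symm
    rw [Complex.ofReal_re]
    positivity
  have hn : ∀ n : ℕ, laplaceTransform m n = 0 := by
    intro n
    rcases Nat.eq_zero_or_pos n with rfl | hn
    · simpa using h0
    · exact h1 _ (by simpa using hn)
  have hn' : ∀ n : ℕ, m.integral (fun s : ℝ≥0 => ((Real.exp (-(s : ℝ)) ^ n : ℝ) : ℂ))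
      (ContinuousLinearMap.mul ℝ ℂ) = 0 := by
    intro n
    rw [← hn n, laplaceTransform]
    congr 1
    ext s
    rw [← Real.exp_nat_mul, Complex.ofReal_exp]
    congr 1
    push_cast
    ring
  have hvar : ∀ (L : ℂ →L[ℝ] ℝ) (t : SignedMeasure ℝ≥0), (∀ z, ‖L z‖ₑ ≤ ‖z‖ₑ) →
      (∀ s, t s = L (m s)) → t = 0 := by
    intro L t hL ht
    set j := t.toJordanDecomposition
    have hle : j.posPart + j.negPart ≤ m.variation := by
      change t.totalVariation ≤ _
      rw [SignedMeasure.totalVariation_eq_variation]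
      refine VectorMeasure.variation_le_of_forall_enorm_le fun E _ => ?_
      rw [ht]
      exact (hL _).trans (VectorMeasure.enorm_measure_le_variation _ _)
    have hPN : j.posPart = j.negPart := by
      refine eq_of_exp _ _ fun n => ?_
      have hin : Integrable (fun s : ℝ≥0 => Real.exp (-(s : ℝ)) ^ n) m.variation := by
        refine Integrable.of_bound (by fun_prop) 1 (Eventually.of_forall fun s => ?_)
        rw [Real.norm_eq_abs, abs_of_pos (by positivity)]
        exact pow_le_one₀ (Real.exp_pos _).le (Real.exp_le_one_iff.2 (by simp))
      have := map_integral m L j.posPart j.negPart 1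
        (by rw [one_smul]; exact (Measure.le_add_right le_rfl).trans hle)
        (by rw [one_smul]; exact (Measure.le_add_left le_rfl).trans hle)
        (fun s hs => by rw [← ht]; exact t.apply_eq_posPart_real_sub_negPart_real hs) hin
      rw [hn', map_zero] at this
      linarith
    ext s hs
    rw [t.apply_eq_posPart_real_sub_negPart_real hs]
    change j.posPart.real s - j.negPart.real s = 0
    rw [hPN, sub_self]
  have hre := hvar Complex.reCLM (ComplexMeasure.re m) (fun z => by
    rw [← ofReal_norm, ← ofReal_norm]
    exact ENNReal.ofReal_le_ofReal (Complex.abs_re_le_norm z)) (fun s => rfl)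
  have him := hvar Complex.imCLM (ComplexMeasure.im m) (fun z => by
    rw [← ofReal_norm, ← ofReal_norm]
    exact ENNReal.ofReal_le_ofReal (Complex.abs_im_le_norm z)) (fun s => rfl)
  ext s hs
  apply Complex.ext
  · exact congrArg (fun t : SignedMeasure ℝ≥0 => t s) hre
  · exact congrArg (fun t : SignedMeasure ℝ≥0 => t s) him

/-- `F` belongs to `A^1_+(ℂ_+)`: on the open right half-plane it is the Laplace transform of a
complex measure on `[0, ∞)`. Only the values of `F` on the open right half-plane matter. -/
def MemA1Plus (F : ℂ → ℂ) : Prop :=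
  ∃ μ : ComplexMeasure ℝ≥0, ∀ z : ℂ, 0 < z.re → F z = laplaceTransform μ z

open Classical in
/-- The norm of `F = ℒμ` in `A^1_+(ℂ_+)`: the total variation `|μ|([0, ∞))` of the (unique) measure
`μ` representing `F`. It is `0` by convention when `F` is not in `A^1_+(ℂ_+)`. -/
noncomputable def normA1Plus (F : ℂ → ℂ) : ℝ :=
  if h : MemA1Plus F then h.choose.variation.real univ else 0

/-- The norm does not depend on a choice: `‖ℒμ‖ = |μ|([0, ∞))`. -/
theorem normA1Plus_eq {F : ℂ → ℂ} {μ : ComplexMeasure ℝ≥0}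
    (h : ∀ z : ℂ, 0 < z.re → F z = laplaceTransform μ z) :
    normA1Plus F = μ.variation.real univ := by
  have hF : MemA1Plus F := ⟨μ, h⟩
  have : hF.choose = μ := laplaceTransform_injective fun z hz => by
    rw [← h z hz, ← hF.choose_spec z hz]
  rw [normA1Plus, dif_pos hF, this]

/-- `f ∈ C^∞(0, ∞)` is completely monotone: `(-1)^n f^{(n)} ≥ 0` on `(0, ∞)` for all `n ≥ 0`. -/
def CompletelyMonotone (f : ℝ → ℝ) : Prop :=
  ContDiffOn ℝ ∞ f (Ioi 0) ∧ ∀ n : ℕ, ∀ x : ℝ, 0 < x → 0 ≤ (-1) ^ n * iteratedDeriv n f x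

/-- A Bernstein function: a nonnegative `φ ∈ C^∞(0, ∞)` with completely monotone derivative. -/
def IsBernstein (φ : ℝ → ℝ) : Prop :=
  ContDiffOn ℝ ∞ φ (Ioi 0) ∧ (∀ x : ℝ, 0 < x → 0 ≤ φ x) ∧ CompletelyMonotone (deriv φ)

/-- The class `Φ` of Bernstein functions with `φ(0+) = 0`, `φ'(0+) = 1` and `φ''(0+)` finite. -/
def Phi : Set (ℝ → ℝ) :=
  {φ | IsBernstein φ ∧ Tendsto φ (𝓝[>] 0) (𝓝 0) ∧ Tendsto (deriv φ) (𝓝[>] 0) (𝓝 1) ∧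
    ∃ c : ℝ, Tendsto (iteratedDeriv 2 φ) (𝓝[>] 0) (𝓝 c)}

/-- `ψ` extends the function `φ` on `(0, ∞)` to the closed right half-plane, continuously, and
holomorphically in the open half-plane. On the closed half-plane there is at most one such `ψ`. -/
def IsHalfPlaneExtension (φ : ℝ → ℝ) (ψ : ℂ → ℂ) : Prop :=
  ContinuousOn ψ {z | 0 ≤ z.re} ∧ DifferentiableOn ℂ ψ {z | 0 < z.re} ∧
    ∀ x : ℝ, 0 < x → ψ x = φ x

end HillePhillips

open HillePhillips

/-!
Both assertions come down to Bernstein's theorem: a completely monotone function `f` with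
`f(0+) = 1` is the Laplace transform of a probability measure on `[0, ∞)`
(`CompletelyMonotone.exists_laplace`).

Applied to `φ'`, it gives a probability measure `P`, and `ψ(z) = ∫ (1 - e^{-sz}) / s P(ds)` is the
extension of `φ`: the integrand is `1`-Lipschitz in `z` on the closed half-plane, and
differentiation under the integral gives `ψ' = ℒP` in the open one
(`IsBernstein.exists_halfPlaneExtension`).

Applied to `e^{-tφ}`, it gives a random variable `S ≥ 0` with `𝔼 e^{-xS} = e^{-tφ(x)}`, and
`φ(x) ≤ x` forces `𝔼 S ≤ t`. Since `∫_0^∞ e^{-ux} (u - s)⁺ du = x^{-2} e^{-sx}`, Fubini's theorem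
gives
`x^{-2} (e^{-tφ(x)} - e^{-tx}) = ∫_0^∞ e^{-ux} (𝔼 (u - S)⁺ - (u - t)⁺) du`,
where the density is nonnegative by Jensen's inequality (`rampGap_nonneg`,
`integral_exp_mul_rampGap`). So the function is the Laplace transform of a positive measure `κ`; in
particular it is completely monotone. The total variation of `κ` is its mass, which by monotone
convergence is the limit of the function at `0+`, and l'Hôpital's rule evaluates this limit as
`-(t / 2) φ''(0+)` (`tendsto_exp_sub_exp_div_sq`). The identity theorem carries the formula from
`(0, ∞)` to the half-plane.

Bernstein's theorem is reduced to Hausdorff's moment problem on grids of mesh `1 / m`: complete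
monotonicity makes the iterated differences alternate in sign, so that, normalized and with binomial
coefficients, they are the weights of a probability measure on `[0, 1]` whose moments nearly are the
values of `f` on the grid. A cluster point of these measures as the mesh tends to `0` represents `f`
at all rational points, hence everywhere, as `∫ y^x Q(dy)`. Since `f(0+) = 1`, the point `y = 0` has
no mass, and `y = e^{-s}` turns `Q` into a measure on `[0, ∞)`.
-/

namespace HillePhillips

/-! ### Completely monotone functions and their differences -/

theorem iteratedDeriv_differentiableAt {f : ℝ → ℝ} (hf : ContDiffOn ℝ ∞ f (Ioi 0)) (n : ℕ) {x : ℝ}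
    (hx : 0 < x) : DifferentiableAt ℝ (iteratedDeriv n f) x := by
  have h := (hf.differentiableOn_iteratedDerivWithin (m := n)
    (by exact_mod_cast WithTop.coe_lt_top _) isOpen_Ioi.uniqueDiffOn).congr
      fun y hy => (iteratedDerivWithin_of_isOpen isOpen_Ioi hy).symm
  exact (h x hx).differentiableAt (Ioi_mem_nhds hx)

theorem CompletelyMonotone.sub_shift {f : ℝ → ℝ} (hf : CompletelyMonotone f) {h : ℝ} (hh : 0 < h) :
    CompletelyMonotone (fun x => f x - f (x + h)) := by
  have hs : ContDiffOn ℝ ∞ (fun x => f (x + h)) (Ioi 0) :=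
    hf.1.comp (by fun_prop) fun x (hx : 0 < x) => by simp only [mem_Ioi]; positivity
  refine ⟨hf.1.sub hs, fun n x hx => ?_⟩
  have e : iteratedDeriv n (fun x => f x - f (x + h)) x =
      iteratedDeriv n f x - iteratedDeriv n f (x + h) := by
    rw [iteratedDeriv_fun_sub, iteratedDeriv_comp_add_const]
    · exact ((hf.1.contDiffAt (Ioi_mem_nhds hx)).of_le (by exact_mod_cast le_top))
    · exact ((hs.contDiffAt (Ioi_mem_nhds hx)).of_le (by exact_mod_cast le_top))
  rw [e]
  have hanti : AntitoneOn (fun y => (-1) ^ n * iteratedDeriv n f y) (Ioi 0) := by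
    have hd : ∀ y ∈ Ioi (0 : ℝ), DifferentiableAt ℝ (fun y => (-1) ^ n * iteratedDeriv n f y) y :=
      fun y hy => (iteratedDeriv_differentiableAt hf.1 n hy).const_mul _
    refine antitoneOn_of_deriv_nonpos (convex_Ioi 0)
      (fun y hy => (hd y hy).continuousAt.continuousWithinAt)
      (fun y hy => (hd y (interior_subset hy)).differentiableWithinAt) fun y hy => ?_
    rw [interior_Ioi] at hy
    have h1 := hf.2 (n + 1) y hy
    rw [iteratedDeriv_succ, pow_succ] at h1
    rw [deriv_const_mul _ (iteratedDeriv_differentiableAt hf.1 n hy)]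
    linarith
  have := hanti (show x ∈ Ioi 0 from hx) (show x + h ∈ Ioi 0 by simp only [mem_Ioi]; positivity)
    (by linarith)
  simp only at this
  linarith

/-- The translation operator `(shift h g)(x) = g(x + h)`, written `E` in the comments below. -/
def shift (h : ℝ) : Module.End ℝ (ℝ → ℝ) where
  toFun g x := g (x + h)
  map_add' _ _ := rfl
  map_smul' _ _ := rfl

theorem shift_pow_apply (h : ℝ) (k : ℕ) (g : ℝ → ℝ) (x : ℝ) :
    (shift h ^ k) g x = g (x + k * h) := by
  induction k generalizing x with
  | zero => simp
  | succ k ih =>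
    rw [pow_succ', Module.End.mul_apply]
    change (shift h ^ k) g (x + h) = _
    rw [ih]
    congr 1
    push_cast
    ring

/-- The mixed differences `E^k (1 - E)^m f` of a completely monotone function are nonnegative, since
`1 - E` preserves complete monotonicity. -/
theorem CompletelyMonotone.shift_diff_nonneg {f : ℝ → ℝ} (hf : CompletelyMonotone f) {h : ℝ}
    (hh : 0 < h) (k m : ℕ) {x : ℝ} (hx : 0 < x) :
    0 ≤ (shift h ^ k * (1 - shift h) ^ m) f x := by
  induction m generalizing f with
  | zero =>
    rw [pow_zero, mul_one, shift_pow_apply]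
    simpa using hf.2 0 (x + k * h) (by positivity)
  | succ m ih =>
    rw [pow_succ, ← mul_assoc, Module.End.mul_apply]
    exact ih (hf.sub_shift hh)

/-- The binomial expansion of `E^j (E + (1 - E))^n = E^j`. -/
theorem sum_choose_shift (h : ℝ) (n j : ℕ) (f : ℝ → ℝ) (x : ℝ) :
    ∑ i ∈ Finset.range (n + 1), (n.choose i : ℝ) * (shift h ^ (j + i) * (1 - shift h) ^ (n - i)) f x
      = f (x + j * h) := by
  have hc : Commute (shift h) (1 - shift h) := (Commute.one_right _).sub_right (Commute.refl _)
  have h1 := hc.add_pow n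
  rw [add_sub_cancel, one_pow] at h1
  rw [← shift_pow_apply h j f x, ← mul_one (shift h ^ j), h1, Finset.mul_sum, LinearMap.sum_apply,
    Finset.sum_apply, ← h1]
  refine Finset.sum_congr rfl fun i _ => ?_
  rw [← mul_assoc, ← mul_assoc, ← pow_add, (Nat.cast_commute (n.choose i) _).eq.symm]
  generalize shift h ^ (j + i) * (1 - shift h) ^ (n - i) = T
  rw [← nsmul_eq_mul (n.choose i) T, LinearMap.smul_apply, Pi.smul_apply, nsmul_eq_mul]

/-- Normalized factorial moments of a distribution on `{0, 1/n, …, 1}` are close to its moments. The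
bound `J` is separate from `j` only for the sake of the induction. -/
theorem abs_descFactorial_div_sub_pow_le {n k J : ℕ} (hk : k ≤ n) (hJ : J < n) {j : ℕ}
    (hj : j ≤ J) :
    |(k.descFactorial j : ℝ) / n.descFactorial j - ((k : ℝ) / n) ^ j| ≤ j * (J / (n - J)) := by
  have hn : (0 : ℝ) < n := by exact_mod_cast (Nat.zero_le J).trans_lt hJ
  have hnJ : (0 : ℝ) < n - J := sub_pos.2 (by exact_mod_cast hJ)
  have hkn : (k : ℝ) ≤ n := by exact_mod_cast hk
  induction j with
  | zero => simp
  | succ j ih =>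
    have ih := ih (by omega)
    have hjJ : (j : ℝ) ≤ J := by exact_mod_cast (by omega : j ≤ J)
    have hnj : (0 : ℝ) < n - j := by linarith
    have hd : (0 : ℝ) < n.descFactorial j := by
      exact_mod_cast Nat.descFactorial_pos.2 (by omega : j ≤ n)
    have hr1 : (k.descFactorial j : ℝ) / n.descFactorial j ≤ 1 :=
      (div_le_one hd).2 (by exact_mod_cast Nat.descFactorial_le j hk)
    have hr0 : 0 ≤ (k.descFactorial j : ℝ) / n.descFactorial j := by positivity
    have hy1 : (k : ℝ) / n ≤ 1 := (div_le_one hn).2 hkn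
    have hy0 : 0 ≤ (k : ℝ) / n := by positivity
    have hb : |((k - j : ℕ) : ℝ) / (n - j) - k / n| ≤ J / (n - J) := by
      have h1 : (j : ℝ) / (n - j) ≤ J / (n - J) :=
        div_le_div₀ (by positivity) hjJ hnJ (by linarith)
      refine le_trans ?_ h1
      rcases le_total j k with h | h
      · rw [Nat.cast_sub h]
        have : ((k : ℝ) - j) / (n - j) - k / n = - (j / (n - j) * (1 - k / n)) := by
          field_simp
          ring
        rw [this, abs_neg, abs_of_nonneg (mul_nonneg (by positivity) (by linarith))]
        exact mul_le_of_le_one_right (by positivity) (by linarith)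
      · rw [Nat.sub_eq_zero_of_le h]
        simp only [Nat.cast_zero, zero_div, zero_sub, abs_neg]
        rw [abs_of_nonneg hy0]
        have hj0 : (0 : ℝ) ≤ j := j.cast_nonneg
        exact div_le_div₀ hj0 (by exact_mod_cast h) hnj (by linarith)
    rw [Nat.descFactorial_succ, Nat.descFactorial_succ, Nat.cast_mul, Nat.cast_mul,
      Nat.cast_sub (by omega : j ≤ n), mul_comm ((k - j : ℕ) : ℝ), mul_comm ((n : ℝ) - j),
      mul_div_mul_comm, pow_succ]
    set r := (k.descFactorial j : ℝ) / n.descFactorial j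
    set y := (k : ℝ) / n
    set w := ((k - j : ℕ) : ℝ) / (n - j)
    have e : r * w - y ^ j * y = r * (w - y) + (r - y ^ j) * y := by ring
    rw [e]
    refine (abs_add_le _ _).trans ?_
    rw [abs_mul, abs_mul, abs_of_nonneg hr0, abs_of_nonneg hy0]
    have h1 : r * |w - y| ≤ |w - y| := mul_le_of_le_one_left (abs_nonneg _) hr1
    have h2 : |r - y ^ j| * y ≤ |r - y ^ j| := mul_le_of_le_one_right (abs_nonneg _) hy1
    push_cast
    linarith

/-- The normalized factorial moments of the weights `(n choose k) E^k (1 - E)^{n - k} f(x)` are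
exactly the values `f (x + j h)`. -/
theorem sum_choose_descFactorial_shift (h : ℝ) {n j : ℕ} (hj : j ≤ n) (f : ℝ → ℝ) (x : ℝ) :
    ∑ k ∈ Finset.range (n + 1), ((k.descFactorial j : ℝ) / n.descFactorial j) *
      ((n.choose k : ℝ) * (shift h ^ k * (1 - shift h) ^ (n - k)) f x) = f (x + j * h) := by
  obtain ⟨N, rfl⟩ := Nat.exists_eq_add_of_le hj
  rw [add_assoc, Finset.sum_range_add, Finset.sum_eq_zero, zero_add, ← sum_choose_shift h N j f x]
  · refine Finset.sum_congr rfl fun i hi => ?_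
    have hi : i ≤ N := by simpa [Nat.lt_succ_iff] using hi
    have h1 : (j + N).choose (j + i) * (j + i).choose j = (j + N).choose j * N.choose i := by
      have := Nat.choose_mul (n := j + N) (k := j + i) (s := j) (by omega)
      simpa using this
    have hpos : ((j + N).choose j : ℝ) ≠ 0 := by
      exact_mod_cast (Nat.choose_pos (by omega : j ≤ j + N)).ne'
    have h2 : (((j + i).descFactorial j : ℝ) / (j + N).descFactorial j) * (j + N).choose (j + i)
        = N.choose i := by
      rw [Nat.descFactorial_eq_factorial_mul_choose, Nat.descFactorial_eq_factorial_mul_choose]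
      have hf : (j.factorial : ℝ) ≠ 0 := by exact_mod_cast j.factorial_ne_zero
      push_cast
      rw [mul_div_mul_left _ _ hf, div_mul_eq_mul_div, div_eq_iff hpos]
      have h3 : (j + i).choose j * (j + N).choose (j + i) = N.choose i * (j + N).choose j := by
        linarith
      exact_mod_cast h3
    rw [← mul_assoc, h2, Nat.add_sub_add_left]
  · intro k hk
    rw [Nat.descFactorial_of_lt (Finset.mem_range.1 hk)]
    simp

/-- The approximate Hausdorff moment problem: the weights
`(n choose k) E^k (1 - E)^{n - k} f(x) / f(x)` at the points `k / n` form a probability measure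
whose moments are nearly `f (x + j h) / f x`. -/
theorem CompletelyMonotone.exists_approx_moments {f : ℝ → ℝ} (hf : CompletelyMonotone f) {h x : ℝ}
    (hh : 0 < h) (hx : 0 < x) (hfx : 0 < f x) (n : ℕ) :
    ∃ Q : ProbabilityMeasure unitInterval, ∀ j < n,
      |∫ y, (y : ℝ) ^ j ∂(Q : Measure unitInterval) - f (x + j * h) / f x| ≤ j * (j / (n - j)) := by
  let w : ℕ → ℝ := fun k => (n.choose k : ℝ) * (shift h ^ k * (1 - shift h) ^ (n - k)) f x / f x
  have hw : ∀ k, 0 ≤ w k := fun k =>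
    div_nonneg (mul_nonneg (by positivity) (hf.shift_diff_nonneg hh k _ hx)) hfx.le
  have hmom : ∀ j ≤ n, ∑ k ∈ Finset.range (n + 1),
      ((k.descFactorial j : ℝ) / n.descFactorial j) * w k = f (x + j * h) / f x := by
    intro j hj
    rw [← sum_choose_descFactorial_shift h hj f x, Finset.sum_div]
    exact Finset.sum_congr rfl fun k _ => (mul_div_assoc _ _ _).symm
  have hsum : ∑ k ∈ Finset.range (n + 1), w k = 1 := by
    have := hmom 0 (Nat.zero_le n)
    simpa [hfx.ne'] using this
  -- `projIcc` only serves to obtain a point of `[0, 1]` for every `k`; it fixes `k / n` for `k ≤ n`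
  let y : ℕ → unitInterval := fun k => Set.projIcc 0 1 zero_le_one ((k : ℝ) / n)
  let Q : Measure unitInterval :=
    ∑ k ∈ Finset.range (n + 1), ENNReal.ofReal (w k) • Measure.dirac (y k)
  have hQ : IsProbabilityMeasure Q := by
    constructor
    simp only [Q, Measure.finsetSum_apply, Measure.smul_apply, measure_univ, smul_eq_mul, mul_one]
    rw [← ENNReal.ofReal_sum_of_nonneg fun k _ => hw k, hsum, ENNReal.ofReal_one]
  refine ⟨⟨Q, hQ⟩, fun j hj => ?_⟩
  have hint : ∫ z, (z : ℝ) ^ j ∂Q = ∑ k ∈ Finset.range (n + 1), ((k : ℝ) / n) ^ j * w k := by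
    rw [integral_finsetSum_measure]
    · refine Finset.sum_congr rfl fun k hk => ?_
      rw [integral_smul_measure, integral_dirac, ENNReal.toReal_ofReal (hw k), smul_eq_mul,
        mul_comm]
      have hkn : (k : ℝ) / n ∈ Icc (0 : ℝ) 1 := by
        have : (k : ℝ) ≤ n := by exact_mod_cast Nat.lt_succ_iff.1 (Finset.mem_range.1 hk)
        exact ⟨by positivity, div_le_one_of_le₀ this (by positivity)⟩
      simp only [y, Set.projIcc_of_mem _ hkn]
    · intro k _
      exact (integrable_dirac (by simp)).smul_measure ENNReal.ofReal_ne_top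
  change |∫ z, (z : ℝ) ^ j ∂Q - _| ≤ _
  rw [hint, ← hmom j hj.le, ← Finset.sum_sub_distrib]
  calc |∑ k ∈ Finset.range (n + 1), (((k : ℝ) / n) ^ j * w k -
        ((k.descFactorial j : ℝ) / n.descFactorial j) * w k)|
      ≤ ∑ k ∈ Finset.range (n + 1), j * ((j : ℝ) / (n - j)) * w k := by
        refine (Finset.abs_sum_le_sum_abs _ _).trans (Finset.sum_le_sum fun k hk => ?_)
        rw [← sub_mul, abs_mul, abs_of_nonneg (hw k), abs_sub_comm]
        exact mul_le_mul_of_nonneg_right (abs_descFactorial_div_sub_pow_le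
          (Nat.lt_succ_iff.1 (Finset.mem_range.1 hk)) hj le_rfl) (hw k)
    _ = _ := by rw [← Finset.mul_sum, hsum, mul_one]

/-! ### Bernstein's theorem -/

/-- The measures of `CompletelyMonotone.exists_approx_moments` for the mesh `1 / m`, moved by
`y ↦ y ^ m` so that the exponents refer to the values of `f` independently of the mesh. The grid
starts at `1 / m`, because `f` is not controlled at `0` itself. -/
theorem CompletelyMonotone.exists_approx_rpow_moments {f : ℝ → ℝ} (hf : CompletelyMonotone f)
    {m : ℕ} (hm : 0 < m) (hfx : 0 < f (1 / m)) (n : ℕ) :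
    ∃ Q : ProbabilityMeasure unitInterval, ∀ j < n,
      |∫ y, (y : ℝ) ^ ((j : ℝ) / m) ∂(Q : Measure unitInterval) - f (1 / m + j / m) / f (1 / m)|
        ≤ j * (j / (n - j)) := by
  have hm' : (0 : ℝ) < m := by exact_mod_cast hm
  obtain ⟨Q, hQ⟩ := hf.exists_approx_moments (h := 1 / m) (x := 1 / m) (by positivity)
    (by positivity) hfx n
  have hc : Continuous fun y : unitInterval => y ^ m := by fun_prop
  refine ⟨Q.map hc.aemeasurable, fun j hj => ?_⟩
  have h := hQ j hj
  rw [mul_one_div] at h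
  rw [ProbabilityMeasure.toMeasure_map, integral_map hc.aemeasurable
    (Measurable.aestronglyMeasurable (by fun_prop))]
  convert h using 4
  ext y
  rw [show ((y ^ m : unitInterval) : ℝ) = (y : ℝ) ^ m from rfl, ← Real.rpow_natCast,
    ← Real.rpow_mul y.2.1, mul_div_cancel₀ _ hm'.ne', Real.rpow_natCast]

/-- The error bound of the approximate moment problem, for the exponent `q m` on the grid of mesh
`1 / m` with `n = m ^ 3` points, tends to `0`. -/
theorem tendsto_moment_error_zero (q : ℝ) :
    Tendsto (fun m : ℕ => (q * m) * ((q * m) / ((m : ℝ) ^ 3 - q * m))) atTop (𝓝 0) := by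
  have h1 : Tendsto (fun m : ℕ => q ^ 2 / ((m : ℝ) - q / m)) atTop (𝓝 0) := by
    refine tendsto_const_nhds.div_atTop ?_
    have h0 : Tendsto (fun m : ℕ => q / (m : ℝ)) atTop (𝓝 0) :=
      tendsto_const_div_atTop_nhds_zero_nat q
    simpa [sub_eq_add_neg] using tendsto_natCast_atTop_atTop.atTop_add h0.neg
  refine h1.congr' ?_
  filter_upwards [eventually_gt_atTop 0] with m hm
  have hm' : (m : ℝ) ≠ 0 := by exact_mod_cast hm.ne'
  have : (m : ℝ) ^ 3 - q * m = m ^ 2 * (m - q / m) := by field_simp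
  rw [this]
  rcases eq_or_ne ((m : ℝ) - q / m) 0 with h | h
  · simp [h]
  · field_simp

/-- A completely monotone function with `f(0+) = 1` is represented at the positive rational points
by a probability measure on `[0, 1]`. -/
theorem CompletelyMonotone.exists_hausdorff_measure {f : ℝ → ℝ} (hf : CompletelyMonotone f)
    (h0 : Tendsto f (𝓝[>] 0) (𝓝 1)) :
    ∃ Q : ProbabilityMeasure unitInterval, ∀ q : ℚ, 0 < q →
      ∫ y, (y : ℝ) ^ (q : ℝ) ∂(Q : Measure unitInterval) = f q := by
  -- every rational number eventually lies on the grid of mesh `1 / l!`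
  let M : ℕ → ℕ := fun l => l.factorial
  have hM : Tendsto M atTop atTop := tendsto_atTop_mono Nat.self_le_factorial tendsto_id
  have hM0 : ∀ l, 0 < M l := Nat.factorial_pos
  have hinv : Tendsto (fun l => 1 / (M l : ℝ)) atTop (𝓝[>] 0) := by
    rw [tendsto_nhdsWithin_iff]
    refine ⟨tendsto_one_div_atTop_nhds_zero_nat.comp hM, Eventually.of_forall fun l => ?_⟩
    have := hM0 l
    simp only [mem_Ioi]
    positivity
  have hex : ∀ l, ∃ Q : ProbabilityMeasure unitInterval, 0 < f (1 / M l) → ∀ j < M l ^ 3,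
      |∫ y, (y : ℝ) ^ ((j : ℝ) / M l) ∂(Q : Measure unitInterval) -
        f (1 / M l + j / M l) / f (1 / M l)| ≤ j * (j / ((M l ^ 3 : ℕ) - j)) := by
    intro l
    by_cases h : 0 < f (1 / M l)
    · obtain ⟨Q, hQ⟩ := hf.exists_approx_rpow_moments (hM0 l) h (M l ^ 3)
      exact ⟨Q, fun _ => hQ⟩
    · exact ⟨⟨Measure.dirac 0, inferInstance⟩, fun h' => absurd h' h⟩
  choose Q hQ using hex
  have hlim : ∀ q : ℚ, 0 < q → Tendsto
      (fun l => ∫ y, (y : ℝ) ^ (q : ℝ) ∂(Q l : Measure unitInterval)) atTop (𝓝 (f q)) := by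
    intro q hq
    have hq' : (0 : ℝ) < q := by exact_mod_cast hq
    have hf1 : Tendsto (fun l => f (1 / M l)) atTop (𝓝 1) := h0.comp hinv
    have hf2 : Tendsto (fun l => f (1 / M l + q) / f (1 / M l)) atTop (𝓝 (f q)) := by
      have hx : Tendsto (fun l => 1 / (M l : ℝ) + q) atTop (𝓝 q) := by
        simpa using (tendsto_nhds_of_tendsto_nhdsWithin hinv).add_const (q : ℝ)
      have hcf : ContinuousAt f q := hf.1.continuousOn.continuousAt (Ioi_mem_nhds hq')
      simpa [Function.comp_def, Pi.div_def] using (hcf.tendsto.comp hx).div hf1 one_ne_zero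
    have herr := (tendsto_moment_error_zero q).comp hM
    rw [← sub_zero (f q)]
    have hdiff : Tendsto (fun l => f (1 / M l + q) / f (1 / M l) -
        ∫ y, (y : ℝ) ^ (q : ℝ) ∂(Q l : Measure unitInterval)) atTop (𝓝 0) := by
      refine squeeze_zero_norm' ?_ herr
      filter_upwards [hf1.eventually (lt_mem_nhds one_pos), eventually_ge_atTop q.den,
        hM.eventually (eventually_gt_atTop ⌈q⌉₊), hM.eventually (eventually_gt_atTop 0)]
        with l hl hden hbig hpos
      obtain ⟨d, hd⟩ := Nat.dvd_factorial q.den_pos hden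
      have hMq : ((q.num.toNat * d : ℕ) : ℝ) = q * M l := by
        have h1 : (q : ℝ) * q.den = q.num := by exact_mod_cast Rat.mul_den_eq_num q
        have h2 : ((q.num.toNat : ℕ) : ℝ) = q.num := by
          exact_mod_cast Int.toNat_of_nonneg (Rat.num_nonneg.2 hq.le)
        have h3 : (M l : ℝ) = q.den * d := by exact_mod_cast hd
        rw [Nat.cast_mul, h2, ← h1, h3]
        ring
      have hMpos : (0 : ℝ) < M l := by exact_mod_cast hpos
      have hlt : q.num.toNat * d < M l ^ 3 := by
        have h1 : (q : ℝ) < M l :=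
          lt_of_le_of_lt (by exact_mod_cast Nat.le_ceil q)
            (by exact_mod_cast hbig : ((⌈q⌉₊ : ℕ) : ℝ) < M l)
        have h2 : (1 : ℝ) ≤ M l := by exact_mod_cast hpos
        have : ((q.num.toNat * d : ℕ) : ℝ) < ((M l ^ 3 : ℕ) : ℝ) := by
          rw [hMq]
          push_cast
          nlinarith [mul_lt_mul_of_pos_right h1 hMpos,
            mul_le_mul_of_nonneg_left h2 (mul_pos hMpos hMpos).le]
        exact_mod_cast this
      have := hQ l hl _ hlt
      rw [hMq, mul_div_cancel_right₀ _ hMpos.ne', abs_sub_comm] at this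
      simpa using this
    simpa using hf2.sub hdiff
  -- `ProbabilityMeasure unitInterval` is compact, so the measures converge along an ultrafilter
  let U : Ultrafilter ℕ := hyperfilter ℕ
  have hU : (U : Filter ℕ) ≤ atTop := by
    rw [← Nat.cofinite_eq_atTop]
    exact hyperfilter_le_cofinite
  obtain ⟨P, -, hP⟩ := isCompact_univ.ultrafilter_le_nhds (U.map Q) (by simp)
  refine ⟨P, fun q hq => ?_⟩
  have hq' : (0 : ℝ) < q := by exact_mod_cast hq
  have hP' : Tendsto Q U (𝓝 P) := hP
  rw [ProbabilityMeasure.tendsto_iff_forall_integral_tendsto] at hP'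
  have hc : Continuous fun y : unitInterval => (y : ℝ) ^ (q : ℝ) :=
    continuous_subtype_val.rpow_const fun _ => Or.inr hq'.le
  have h1 := hP' (BoundedContinuousFunction.mkOfCompact ⟨_, hc⟩)
  exact tendsto_nhds_unique h1 ((hlim q hq).mono_left hU)

theorem tendsto_one_div_nhdsGT :
    Tendsto (fun n : ℕ => 1 / ((n : ℝ) + 1)) atTop (𝓝[>] 0) :=
  tendsto_nhdsWithin_iff.2 ⟨tendsto_one_div_add_atTop_nhds_zero_nat,
    Eventually.of_forall fun n => by simp only [mem_Ioi]; positivity⟩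

/-- **Bernstein's theorem** for completely monotone functions with `f(0+) = 1`. -/
theorem CompletelyMonotone.exists_laplace {f : ℝ → ℝ} (hf : CompletelyMonotone f)
    (h0 : Tendsto f (𝓝[>] 0) (𝓝 1)) :
    ∃ P : Measure ℝ≥0, IsProbabilityMeasure P ∧
      ∀ x : ℝ, 0 < x → f x = ∫ s : ℝ≥0, Real.exp (-(s : ℝ) * x) ∂P := by
  obtain ⟨Q, hQ⟩ := hf.exists_hausdorff_measure h0
  have hprob : IsProbabilityMeasure (Q : Measure unitInterval) := inferInstance
  generalize (Q : Measure unitInterval) = ν at hQ hprob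
  have hbd : ∀ (y : unitInterval) (x : ℝ), 0 < x → ‖(y : ℝ) ^ x‖ ≤ 1 := fun y x hx => by
    rw [Real.norm_eq_abs, abs_of_nonneg (Real.rpow_nonneg y.2.1 _)]
    exact Real.rpow_le_one y.2.1 y.2.2 hx.le
  have hmeas : ∀ x : ℝ, Measurable fun y : unitInterval => (y : ℝ) ^ x := fun x => by fun_prop
  have hcont : ContinuousOn (fun x : ℝ => ∫ y : unitInterval, (y : ℝ) ^ x ∂ν) (Ioi 0) := by
    refine continuousOn_of_dominated (bound := fun _ => 1)
      (fun x _ => (hmeas x).aestronglyMeasurable)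
      (fun x hx => Eventually.of_forall fun y => hbd y x hx) (integrable_const _)
      (Eventually.of_forall fun y x hx => ?_)
    exact (Real.continuousAt_const_rpow' (ne_of_gt hx)).continuousWithinAt
  have hall : ∀ x : ℝ, 0 < x → ∫ y : unitInterval, (y : ℝ) ^ x ∂ν = f x := by
    have : EqOn (fun x : ℝ => ∫ y : unitInterval, (y : ℝ) ^ x ∂ν) f
        (Ioi 0 ∩ range ((↑) : ℚ → ℝ)) := by
      rintro _ ⟨hx, q, rfl⟩
      exact hQ q (Rat.cast_pos.1 (mem_Ioi.1 hx))
    exact this.of_subset_closure hcont hf.1.continuousOn inter_subset_left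
      (Rat.denseRange_cast.open_subset_closure_inter isOpen_Ioi)
  -- the limit `x → 0+` shows that there is no mass at `y = 0`
  have hpos : ∀ᵐ y ∂ν, y ≠ 0 := by
    have ht : Tendsto (fun n : ℕ => ∫ y : unitInterval, (y : ℝ) ^ (1 / ((n : ℝ) + 1)) ∂ν) atTop
        (𝓝 (∫ y : unitInterval, ({0}ᶜ : Set unitInterval).indicator (fun _ => (1 : ℝ)) y ∂ν)) := by
      refine tendsto_integral_of_dominated_convergence (fun _ => 1)
        (fun n => (hmeas _).aestronglyMeasurable) (integrable_const _)
        (fun n => Eventually.of_forall fun y => hbd y _ (by positivity))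
        (Eventually.of_forall fun y => ?_)
      by_cases hy : y = 0
      · subst hy
        have : ∀ n : ℕ, (0 : ℝ) ^ (1 / ((n : ℝ) + 1)) = 0 := fun n =>
          Real.zero_rpow (by positivity)
        simp only [Icc.coe_zero, this]
        simp
      · have hy' : (y : ℝ) ≠ 0 := fun h => hy (Subtype.ext h)
        have := (Real.continuous_const_rpow hy').tendsto 0 |>.comp
          (tendsto_one_div_add_atTop_nhds_zero_nat (𝕜 := ℝ))
        simpa [hy, Function.comp_def] using this
    have h1 : Tendsto (fun n : ℕ => ∫ y : unitInterval, (y : ℝ) ^ (1 / ((n : ℝ) + 1)) ∂ν) atTop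
        (𝓝 1) := by
      exact (h0.comp tendsto_one_div_nhdsGT).congr fun n => (hall _ (by positivity)).symm
    have h2 := tendsto_nhds_unique ht h1
    rw [integral_indicator_const _ (measurableSet_singleton _).compl, smul_eq_mul, mul_one] at h2
    have h3 : ν {0}ᶜ = 1 := by
      rw [Measure.real, ENNReal.toReal_eq_one_iff] at h2
      exact h2
    rw [prob_compl_eq_one_iff (measurableSet_singleton _)] at h3
    exact compl_mem_ae_iff.2 h3
  have hm : Measurable fun y : unitInterval => Real.toNNReal (-Real.log y) := by fun_prop
  -- substitute `y = e^{-s}`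
  refine ⟨ν.map fun y : unitInterval => Real.toNNReal (-Real.log y),
    Measure.isProbabilityMeasure_map hm.aemeasurable, fun x hx => ?_⟩
  rw [← hall x hx, integral_map hm.aemeasurable (Measurable.aestronglyMeasurable (by fun_prop))]
  refine integral_congr_ae ?_
  filter_upwards [hpos] with y hy
  have hy' : (0 : ℝ) < y := lt_of_le_of_ne y.2.1 fun h => hy (Subtype.ext h.symm)
  rw [Real.coe_toNNReal _ (neg_nonneg.2 (Real.log_nonpos y.2.1 y.2.2)), neg_neg,
    Real.rpow_def_of_pos hy']

/-! ### Bernstein functions -/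

theorem le_of_antitoneOn_tendsto {f : ℝ → ℝ} (hf : AntitoneOn f (Ioi 0)) {L : ℝ}
    (h0 : Tendsto f (𝓝[>] 0) (𝓝 L)) {x : ℝ} (hx : 0 < x) : f x ≤ L := by
  refine ge_of_tendsto h0 ?_
  filter_upwards [Ioo_mem_nhdsGT hx] with y hy
  exact hf hy.1 hx hy.2.le

theorem CompletelyMonotone.antitoneOn {f : ℝ → ℝ} (hf : CompletelyMonotone f) :
    AntitoneOn f (Ioi 0) := by
  intro x hx y _ hxy
  rcases hxy.eq_or_lt with rfl | hlt
  · exact le_rfl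
  have := (hf.sub_shift (sub_pos.2 hlt)).2 0 x hx
  simpa using this

theorem IsBernstein.differentiableAt {φ : ℝ → ℝ} (hφ : IsBernstein φ) {x : ℝ} (hx : 0 < x) :
    DifferentiableAt ℝ φ x := by
  simpa using iteratedDeriv_differentiableAt hφ.1 0 hx

theorem IsBernstein.differentiableAt_deriv {φ : ℝ → ℝ} (hφ : IsBernstein φ) {x : ℝ} (hx : 0 < x) :
    DifferentiableAt ℝ (deriv φ) x := by
  simpa using iteratedDeriv_differentiableAt hφ.1 1 hx

theorem IsBernstein.contDiffOn_exp {φ : ℝ → ℝ} (hφ : IsBernstein φ) (t : ℝ) :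
    ContDiffOn ℝ ∞ (fun x => Real.exp (-t * φ x)) (Ioi 0) :=
  (contDiffOn_const.mul hφ.1).exp

theorem IsBernstein.hasDerivAt_exp {φ : ℝ → ℝ} (hφ : IsBernstein φ) (t : ℝ) {x : ℝ} (hx : 0 < x) :
    HasDerivAt (fun x => Real.exp (-t * φ x)) (-t * (deriv φ x * Real.exp (-t * φ x))) x := by
  have := ((hφ.differentiableAt hx).hasDerivAt.const_mul (-t)).exp
  convert this using 1
  ring

/-- If `φ` is a Bernstein function, then `e^{-tφ}` is completely monotone: in
`(e^{-tφ})' = -t φ' e^{-tφ}` the Leibniz rule expresses the derivatives of order `n + 1` through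
those of order at most `n`. -/
theorem IsBernstein.completelyMonotone_exp {φ : ℝ → ℝ} (hφ : IsBernstein φ) {t : ℝ} (ht : 0 ≤ t) :
    CompletelyMonotone (fun x => Real.exp (-t * φ x)) := by
  refine ⟨hφ.contDiffOn_exp t, fun n => ?_⟩
  induction n using Nat.strong_induction_on with
  | _ n ih =>
    intro x hx
    rcases n with _ | n
    · simp only [pow_zero, iteratedDeriv_zero, one_mul]
      positivity
    have hev : deriv (fun x => Real.exp (-t * φ x)) =ᶠ[𝓝 x]
        fun x => -t * (deriv φ x * Real.exp (-t * φ x)) := by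
      filter_upwards [Ioi_mem_nhds hx] with y hy using (hφ.hasDerivAt_exp t hy).deriv
    rw [iteratedDeriv_succ', hev.iteratedDeriv_eq, iteratedDeriv_const_mul_field,
      iteratedDeriv_fun_mul
      ((hφ.2.2.1.contDiffAt (Ioi_mem_nhds hx)).of_le (by exact_mod_cast le_top))
      (((hφ.contDiffOn_exp t).contDiffAt (Ioi_mem_nhds hx)).of_le (by exact_mod_cast le_top))]
    have e : (-1 : ℝ) ^ (n + 1) * (-t * ∑ i ∈ Finset.range (n + 1), (n.choose i : ℝ) *
        iteratedDeriv i (deriv φ) x * iteratedDeriv (n - i) (fun x => Real.exp (-t * φ x)) x) =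
        t * ∑ i ∈ Finset.range (n + 1), (n.choose i : ℝ) *
          ((-1) ^ i * iteratedDeriv i (deriv φ) x) *
            ((-1) ^ (n - i) * iteratedDeriv (n - i) (fun x => Real.exp (-t * φ x)) x) := by
      rw [pow_succ, Finset.mul_sum, Finset.mul_sum, Finset.mul_sum]
      refine Finset.sum_congr rfl fun i hi => ?_
      have : (-1 : ℝ) ^ n = (-1) ^ i * (-1) ^ (n - i) := by
        rw [← pow_add, Nat.add_sub_cancel' (Nat.lt_succ_iff.1 (Finset.mem_range.1 hi))]
      rw [this]
      ring
    rw [e]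
    refine mul_nonneg ht (Finset.sum_nonneg fun i _ => ?_)
    exact mul_nonneg (mul_nonneg (by positivity) (hφ.2.2.2 i x hx)) (ih (n - i) (by omega) x hx)

/-- A Bernstein function with `φ(0+) = 0` and `φ'(0+) = 1` lies below the identity. -/
theorem IsBernstein.le_self {φ : ℝ → ℝ} (hφ : IsBernstein φ) (h0 : Tendsto φ (𝓝[>] 0) (𝓝 0))
    (h1 : Tendsto (deriv φ) (𝓝[>] 0) (𝓝 1)) {x : ℝ} (hx : 0 < x) : φ x ≤ x := by
  have hd : ∀ y : ℝ, 0 < y → HasDerivAt (fun y => φ y - y) (deriv φ y - 1) y := fun y hy =>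
    (hφ.differentiableAt hy).hasDerivAt.sub (hasDerivAt_id y)
  have hanti : AntitoneOn (fun y => φ y - y) (Ioi 0) := by
    refine antitoneOn_of_deriv_nonpos (convex_Ioi 0)
      (fun y hy => (hd y hy).continuousAt.continuousWithinAt)
      (fun y hy => (hd y (interior_subset hy)).differentiableAt.differentiableWithinAt)
      fun y hy => ?_
    rw [interior_Ioi] at hy
    rw [(hd y hy).deriv]
    linarith [le_of_antitoneOn_tendsto hφ.2.2.antitoneOn h1 hy]
  have hl : Tendsto (fun y => φ y - y) (𝓝[>] 0) (𝓝 0) := by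
    simpa using h0.sub (tendsto_nhdsWithin_of_tendsto_nhds (tendsto_id (x := 𝓝 (0 : ℝ))))
  linarith [le_of_antitoneOn_tendsto hanti hl hx]

/-- The value at `0+`, by l'Hôpital's rule applied twice. -/
theorem tendsto_exp_sub_exp_div_sq {φ : ℝ → ℝ} (hφ : IsBernstein φ)
    (h0 : Tendsto φ (𝓝[>] 0) (𝓝 0)) (h1 : Tendsto (deriv φ) (𝓝[>] 0) (𝓝 1)) {c : ℝ}
    (hc : Tendsto (iteratedDeriv 2 φ) (𝓝[>] 0) (𝓝 c)) (t : ℝ) :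
    Tendsto (fun x => (Real.exp (-t * φ x) - Real.exp (-t * x)) / x ^ 2) (𝓝[>] 0)
      (𝓝 (t / 2 * -c)) := by
  have hid : Tendsto (fun x : ℝ => x) (𝓝[>] 0) (𝓝 0) :=
    tendsto_nhdsWithin_of_tendsto_nhds tendsto_id
  have hE : Tendsto (fun x => Real.exp (-t * φ x)) (𝓝[>] 0) (𝓝 1) := by
    simpa [Function.comp_def] using (Real.continuous_exp.tendsto _).comp (h0.const_mul (-t))
  have hX : Tendsto (fun x => Real.exp (-t * x)) (𝓝[>] 0) (𝓝 1) := by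
    simpa [Function.comp_def] using (Real.continuous_exp.tendsto _).comp (hid.const_mul (-t))
  have dX : ∀ x : ℝ, HasDerivAt (fun x => Real.exp (-t * x)) (-t * Real.exp (-t * x)) x := by
    intro x
    have := ((hasDerivAt_id' x).const_mul (-t)).exp
    convert this using 1
    ring
  have dE := fun {x : ℝ} (hx : 0 < x) => hφ.hasDerivAt_exp t hx
  have d2 : ∀ {x : ℝ}, 0 < x → HasDerivAt (deriv φ) (iteratedDeriv 2 φ x) x := by
    intro x hx
    rw [iteratedDeriv_succ, iteratedDeriv_one]
    exact (hφ.differentiableAt_deriv hx).hasDerivAt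
  refine HasDerivAt.lhopital_zero_nhdsGT
    (f' := fun x => -t * (deriv φ x * Real.exp (-t * φ x)) - -t * Real.exp (-t * x))
    (g' := fun x => 2 * x) ?_ ?_ ?_ ?_ ?_ ?_
  · filter_upwards [self_mem_nhdsWithin] with x hx using (dE hx).sub (dX x)
  · filter_upwards [self_mem_nhdsWithin] with x hx
    simpa using hasDerivAt_pow 2 x
  · filter_upwards [self_mem_nhdsWithin] with x hx
    exact mul_ne_zero two_ne_zero (ne_of_gt hx)
  · simpa using hE.sub hX
  · simpa using hid.pow 2
  refine HasDerivAt.lhopital_zero_nhdsGT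
    (f' := fun x => -t * (iteratedDeriv 2 φ x * Real.exp (-t * φ x) +
      deriv φ x * (-t * (deriv φ x * Real.exp (-t * φ x)))) - -t * (-t * Real.exp (-t * x)))
    (g' := fun x => 2) ?_ ?_ ?_ ?_ ?_ ?_
  · filter_upwards [self_mem_nhdsWithin] with x hx
    exact (((d2 hx).mul (dE hx)).const_mul (-t)).sub ((dX x).const_mul (-t))
  · filter_upwards [self_mem_nhdsWithin] with x hx
    simpa using (hasDerivAt_id x).const_mul (2 : ℝ)
  · exact Eventually.of_forall fun _ => two_ne_zero
  · simpa using ((h1.mul hE).const_mul (-t)).sub (hX.const_mul (-t))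
  · simpa using hid.const_mul 2
  · have := ((((hc.mul hE).add (h1.mul ((h1.mul hE).const_mul (-t)))).const_mul (-t)).sub
      ((hX.const_mul (-t)).const_mul (-t))).div_const 2
    convert this using 2
    ring

theorem IsBernstein.second_deriv_limit_nonpos {φ : ℝ → ℝ} (hφ : IsBernstein φ) {c : ℝ}
    (hc : Tendsto (iteratedDeriv 2 φ) (𝓝[>] 0) (𝓝 c)) : c ≤ 0 := by
  refine le_of_tendsto hc ?_
  filter_upwards [self_mem_nhdsWithin] with x hx
  have := hφ.2.2.2 1 x hx
  rw [iteratedDeriv_succ']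
  linarith

/-! ### Laplace transforms: mean and the ramp function -/

theorem integrable_exp_neg_mul (P : Measure ℝ≥0) [IsFiniteMeasure P] {x : ℝ} (hx : 0 ≤ x) :
    Integrable (fun s : ℝ≥0 => Real.exp (-(s : ℝ) * x)) P := by
  refine Integrable.of_bound (by fun_prop) 1 (Eventually.of_forall fun s => ?_)
  rw [Real.norm_eq_abs, abs_of_pos (Real.exp_pos _), Real.exp_le_one_iff, neg_mul, neg_nonpos]
  positivity

/-- A probability measure on `[0, ∞)` whose Laplace transform is at least `1 - tx` has mean at most
`t`. -/
theorem lintegral_coe_le_of_laplace {P : Measure ℝ≥0} [IsProbabilityMeasure P] {t : ℝ}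
    (h : ∀ x : ℝ, 0 < x → 1 - t * x ≤ ∫ s : ℝ≥0, Real.exp (-(s : ℝ) * x) ∂P) :
    ∫⁻ s : ℝ≥0, s ∂P ≤ ENNReal.ofReal t := by
  -- Fatou's lemma for the difference quotients `(1 - e^{-xs}) / x → s` at `x = 1 / (n + 1)`
  let f : ℕ → ℝ≥0 → ℝ≥0∞ := fun n s =>
    ENNReal.ofReal ((1 - Real.exp (-(s : ℝ) * (1 / ((n : ℝ) + 1)))) / (1 / ((n : ℝ) + 1)))
  have hlim : ∀ s : ℝ≥0, Tendsto (fun n => f n s) atTop (𝓝 (s : ℝ≥0∞)) := by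
    intro s
    have hd : HasDerivAt (fun x : ℝ => -Real.exp (-(s : ℝ) * x)) s 0 := by
      have := (((hasDerivAt_id (0 : ℝ)).const_mul (-(s : ℝ))).exp).fun_neg
      simpa using this
    have h1 := (hd.tendsto_slope.mono_left
      (nhdsWithin_mono _ fun x (hx : 0 < x) => ne_of_gt hx)).comp tendsto_one_div_nhdsGT
    have h2 := ENNReal.tendsto_ofReal h1
    rw [ENNReal.ofReal_coe_nnreal] at h2
    refine h2.congr fun n => ?_
    simp only [Function.comp_apply, slope_def_field, f]
    rw [mul_zero, Real.exp_zero, sub_zero]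
    congr 1
    ring
  have hle : ∀ n, ∫⁻ s, f n s ∂P ≤ ENNReal.ofReal t := by
    intro n
    have hx : (0 : ℝ) < 1 / ((n : ℝ) + 1) := by positivity
    have hi := integrable_exp_neg_mul P hx.le
    have hi2 : Integrable (fun s : ℝ≥0 =>
        (1 - Real.exp (-(s : ℝ) * (1 / ((n : ℝ) + 1)))) / (1 / ((n : ℝ) + 1))) P :=
      ((integrable_const _).sub hi).div_const _
    rw [← ofReal_integral_eq_lintegral_ofReal hi2]
    · refine ENNReal.ofReal_le_ofReal ?_
      rw [integral_div, integral_sub (integrable_const _) hi, div_le_iff₀ hx]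
      have := h _ hx
      simp only [integral_const, probReal_univ, smul_eq_mul, one_mul]
      linarith
    · refine Eventually.of_forall fun s => div_nonneg (sub_nonneg.2 ?_) hx.le
      rw [Real.exp_le_one_iff, neg_mul, neg_nonpos]
      positivity
  calc ∫⁻ s : ℝ≥0, s ∂P = ∫⁻ s, liminf (fun n => f n s) atTop ∂P :=
        lintegral_congr fun s => (hlim s).liminf_eq.symm
    _ ≤ liminf (fun n => ∫⁻ s, f n s ∂P) atTop := lintegral_liminf_le fun n => by fun_prop
    _ ≤ ENNReal.ofReal t := by
      refine (liminf_le_liminf (Eventually.of_forall hle)).trans ?_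
      simp

theorem integral_exp_mul_ramp {x s : ℝ} (hx : 0 < x) (hs : 0 ≤ s) :
    ∫ u in Ioi (0 : ℝ), Real.exp (-u * x) * max (u - s) 0 = Real.exp (-s * x) / x ^ 2 := by
  -- an explicit antiderivative on `(s, ∞)`, vanishing at infinity
  have hd : ∀ u : ℝ, HasDerivAt (fun u => -(Real.exp (-u * x) * ((u - s) / x + 1 / x ^ 2)))
      (Real.exp (-u * x) * (u - s)) u := by
    intro u
    have h1 : HasDerivAt (fun u : ℝ => Real.exp (-u * x)) (Real.exp (-u * x) * (-1 * x)) u :=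
      ((hasDerivAt_id u).neg.mul_const x).exp
    have h2 : HasDerivAt (fun u : ℝ => (u - s) / x + 1 / x ^ 2) (1 / x) u :=
      (((hasDerivAt_id u).sub_const s).div_const x).add_const _
    refine (h1.fun_mul h2).fun_neg.congr_deriv ?_
    field_simp
    ring
  have hlim : Tendsto (fun u => -(Real.exp (-u * x) * ((u - s) / x + 1 / x ^ 2))) atTop (𝓝 0) := by
    have h1 : Tendsto (fun u : ℝ => u * x) atTop atTop := tendsto_id.atTop_mul_const hx
    have e0 := (Real.tendsto_pow_mul_exp_neg_atTop_nhds_zero 0).comp h1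
    have e1 := (Real.tendsto_pow_mul_exp_neg_atTop_nhds_zero 1).comp h1
    have := ((e1.mul_const (1 / x ^ 2)).add (e0.mul_const (1 / x ^ 2 - s / x))).neg
    simp only [zero_mul, add_zero, neg_zero] at this
    refine this.congr fun u => ?_
    simp only [Function.comp_apply, pow_one, pow_zero, one_mul, neg_mul]
    have : u * x * (1 / x ^ 2) = u / x := by field_simp
    linear_combination -Real.exp (-(u * x)) * this
  have hmain : ∫ u in Ioi s, Real.exp (-u * x) * (u - s) = Real.exp (-s * x) / x ^ 2 := by
    rw [integral_Ioi_of_hasDerivAt_of_nonneg' (fun u _ => hd u)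
      (fun u (hu : s < u) => mul_nonneg (Real.exp_pos _).le (sub_nonneg.2 hu.le)) hlim]
    simp
    ring
  rw [← hmain, ← integral_indicator measurableSet_Ioi, ← integral_indicator measurableSet_Ioi]
  congr 1
  ext u
  by_cases hu : s < u
  · have hu0 : 0 < u := hs.trans_lt hu
    simp [indicator, hu, hu0, hu.le]
  · have : u - s ≤ 0 := by linarith
    simp [indicator, hu, max_eq_right this]

/-! ### The positive measure behind the difference of exponentials -/

/-- The density `u ↦ 𝔼 (u - S)⁺ - (u - t)⁺`, where `S` has distribution `P`. -/
noncomputable def rampGap (P : Measure ℝ≥0) (t u : ℝ) : ℝ :=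
  (∫ s : ℝ≥0, max (u - s) 0 ∂P) - max (u - t) 0

theorem abs_ramp_le {u s : ℝ} (hu : 0 ≤ u) (hs : 0 ≤ s) : |max (u - s) 0| ≤ u := by
  rw [abs_of_nonneg (le_max_right _ _)]
  exact max_le (by linarith) hu

theorem integrable_ramp (P : Measure ℝ≥0) [IsFiniteMeasure P] (u : ℝ) :
    Integrable (fun s : ℝ≥0 => max (u - (s : ℝ)) 0) P := by
  refine Integrable.of_bound (by fun_prop) (max u 0) (Eventually.of_forall fun s => ?_)
  rw [Real.norm_eq_abs, abs_of_nonneg (le_max_right _ _)]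
  exact max_le_max_right 0 (by linarith [s.coe_nonneg])

theorem measurable_rampGap (P : Measure ℝ≥0) [IsFiniteMeasure P] (t : ℝ) :
    Measurable (rampGap P t) := by
  refine Measurable.sub (Monotone.measurable fun u v huv => ?_) (by fun_prop)
  exact integral_mono (integrable_ramp P u) (integrable_ramp P v) fun s =>
    max_le_max_right 0 (by linarith)

/-- Jensen's inequality for the convex function `s ↦ (u - s)⁺`. -/
theorem rampGap_nonneg {P : Measure ℝ≥0} [IsProbabilityMeasure P] {t : ℝ} (ht : 0 ≤ t)
    (hP : ∫⁻ s : ℝ≥0, s ∂P ≤ ENNReal.ofReal t) (u : ℝ) : 0 ≤ rampGap P t u := by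
  have hint : Integrable (fun s : ℝ≥0 => (s : ℝ)) P := by
    refine ⟨by fun_prop, ?_⟩
    rw [hasFiniteIntegral_iff_enorm]
    refine lt_of_le_of_lt (le_trans (lintegral_mono fun s => ?_) hP) ENNReal.ofReal_lt_top
    simp
  have hmean : ∫ s : ℝ≥0, (s : ℝ) ∂P ≤ t := by
    rw [integral_eq_lintegral_of_nonneg_ae (Eventually.of_forall fun s => s.coe_nonneg)
      (by fun_prop)]
    refine ENNReal.toReal_le_of_le_ofReal ht (le_trans (lintegral_mono fun s => ?_) hP)
    simp
  rw [rampGap, sub_nonneg]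
  refine max_le ?_ (integral_nonneg fun s => le_max_right _ _)
  calc u - t ≤ u - ∫ s : ℝ≥0, (s : ℝ) ∂P := by linarith
    _ = ∫ s : ℝ≥0, (u - (s : ℝ)) ∂P := by
      rw [integral_sub (integrable_const _) hint]
      simp
    _ ≤ _ := integral_mono ((integrable_const _).sub hint) (integrable_ramp P u) fun s =>
      le_max_left _ _

theorem rampGap_le {P : Measure ℝ≥0} [IsProbabilityMeasure P] {t u : ℝ} (hu : 0 ≤ u) :
    rampGap P t u ≤ u := by
  have : ∫ s : ℝ≥0, max (u - (s : ℝ)) 0 ∂P ≤ ∫ s : ℝ≥0, u ∂P :=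
    integral_mono (integrable_ramp P u) (integrable_const _) fun s =>
      (le_abs_self _).trans (abs_ramp_le hu s.coe_nonneg)
  simp only [integral_const, probReal_univ, smul_eq_mul, one_mul] at this
  have h2 := le_max_right (u - t) 0
  rw [rampGap]
  linarith

theorem integrableOn_exp_mul_self {x : ℝ} (hx : 0 < x) :
    IntegrableOn (fun u => Real.exp (-u * x) * u) (Ioi 0) := by
  have h := integral_exp_mul_ramp hx le_rfl
  have h2 : IntegrableOn (fun u => Real.exp (-u * x) * max (u - 0) 0) (Ioi 0) := by
    refine Integrable.of_integral_ne_zero ?_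
    rw [h]
    positivity
  refine h2.congr_fun (fun u (hu : 0 < u) => ?_) measurableSet_Ioi
  simp [hu.le]

theorem integrableOn_exp_mul_rampGap {P : Measure ℝ≥0} [IsProbabilityMeasure P] {t x : ℝ}
    (ht : 0 ≤ t) (hP : ∫⁻ s : ℝ≥0, s ∂P ≤ ENNReal.ofReal t) (hx : 0 < x) :
    IntegrableOn (fun u => Real.exp (-u * x) * rampGap P t u) (Ioi 0) := by
  refine (integrableOn_exp_mul_self hx).mono'
    (Measurable.aestronglyMeasurable (Measurable.mul (by fun_prop) (measurable_rampGap P t))) ?_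
  filter_upwards [ae_restrict_mem measurableSet_Ioi] with u (hu : 0 < u)
  rw [norm_mul, Real.norm_eq_abs, Real.norm_eq_abs, abs_of_pos (Real.exp_pos _),
    abs_of_nonneg (rampGap_nonneg ht hP u)]
  exact mul_le_mul_of_nonneg_left (rampGap_le hu.le) (Real.exp_pos _).le

/-- The Laplace transform of the density, by Fubini's theorem and `integral_exp_mul_ramp`. -/
theorem integral_exp_mul_rampGap {P : Measure ℝ≥0} [IsProbabilityMeasure P] {t x : ℝ} (ht : 0 ≤ t)
    (hx : 0 < x) :
    ∫ u in Ioi (0 : ℝ), Real.exp (-u * x) * rampGap P t u =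
      (∫ s : ℝ≥0, Real.exp (-(s : ℝ) * x) ∂P - Real.exp (-t * x)) / x ^ 2 := by
  have hprod : Integrable (Function.uncurry fun (u : ℝ) (s : ℝ≥0) =>
      Real.exp (-u * x) * max (u - (s : ℝ)) 0) ((volume.restrict (Ioi 0)).prod P) := by
    refine Integrable.mono' ((integrableOn_exp_mul_self hx).comp_fst P)
      (Measurable.aestronglyMeasurable (by unfold Function.uncurry; fun_prop)) ?_
    have h0 : ∀ᵐ p ∂((volume.restrict (Ioi (0 : ℝ))).prod P), 0 < p.1 :=
      Measure.quasiMeasurePreserving_fst.ae (ae_restrict_mem measurableSet_Ioi)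
    filter_upwards [h0] with p hp
    simp only [Function.uncurry]
    rw [norm_mul, Real.norm_eq_abs, Real.norm_eq_abs, abs_of_pos (Real.exp_pos _)]
    exact mul_le_mul_of_nonneg_left (abs_ramp_le hp.le p.2.coe_nonneg) (Real.exp_pos _).le
  have hramp : ∀ s : ℝ, 0 ≤ s →
      IntegrableOn (fun u => Real.exp (-u * x) * max (u - s) 0) (Ioi 0) := by
    intro s hs
    refine Integrable.of_integral_ne_zero ?_
    rw [integral_exp_mul_ramp hx hs]
    positivity
  have e : ∀ u, Real.exp (-u * x) * rampGap P t u =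
      (∫ s : ℝ≥0, Real.exp (-u * x) * max (u - (s : ℝ)) 0 ∂P) -
        Real.exp (-u * x) * max (u - t) 0 := by
    intro u
    rw [rampGap, mul_sub, integral_const_mul]
  simp only [e]
  have hleft : IntegrableOn (fun u : ℝ =>
      ∫ s : ℝ≥0, Real.exp (-u * x) * max (u - (s : ℝ)) 0 ∂P) (Ioi 0) := hprod.integral_prod_left
  rw [integral_sub hleft (hramp t ht), integral_integral_swap hprod,
    integral_exp_mul_ramp hx ht]
  simp only [fun s : ℝ≥0 => integral_exp_mul_ramp hx s.coe_nonneg]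
  rw [integral_div, sub_div]

/-- `x^{-2} (ℒP(x) - e^{-tx})` is the Laplace transform of a positive measure if `P` has mean at
most `t`. -/
theorem exists_laplace_sub_exp_div_sq {P : Measure ℝ≥0} [IsProbabilityMeasure P] {t : ℝ}
    (ht : 0 ≤ t) (hP : ∫⁻ s : ℝ≥0, s ∂P ≤ ENNReal.ofReal t) :
    ∃ κ : Measure ℝ≥0, ∀ x : ℝ, 0 < x → Integrable (fun s : ℝ≥0 => Real.exp (-(s : ℝ) * x)) κ ∧
      ∫ s : ℝ≥0, Real.exp (-(s : ℝ) * x) ∂κ =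
        (∫ s : ℝ≥0, Real.exp (-(s : ℝ) * x) ∂P - Real.exp (-t * x)) / x ^ 2 := by
  have hk := measurable_rampGap P t
  let κ₀ : Measure ℝ := (volume.restrict (Ioi 0)).withDensity fun u =>
    ENNReal.ofReal (rampGap P t u)
  have hreal : ∀ u, (ENNReal.ofReal (rampGap P t u)).toReal = rampGap P t u := fun u =>
    ENNReal.toReal_ofReal (rampGap_nonneg ht hP u)
  have hae : ∀ᵐ u ∂κ₀, 0 < u :=
    (withDensity_absolutelyContinuous _ _).ae_le (ae_restrict_mem measurableSet_Ioi)
  have hmap : ∀ x : ℝ, (fun u : ℝ => Real.exp (-((Real.toNNReal u : ℝ≥0) : ℝ) * x)) =ᵐ[κ₀]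
      fun u => Real.exp (-u * x) := by
    intro x
    filter_upwards [hae] with u hu
    rw [Real.coe_toNNReal _ hu.le]
  refine ⟨κ₀.map Real.toNNReal, fun x hx => ⟨?_, ?_⟩⟩
  · rw [integrable_map_measure (by fun_prop) (by fun_prop)]
    refine Integrable.congr ?_ (hmap x).symm
    rw [integrable_withDensity_iff hk.ennreal_ofReal
      (Eventually.of_forall fun _ => ENNReal.ofReal_lt_top)]
    simp only [hreal]
    exact integrableOn_exp_mul_rampGap ht hP hx
  · rw [integral_map (by fun_prop) (by fun_prop), integral_congr_ae (hmap x),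
      integral_withDensity_eq_integral_toReal_smul hk.ennreal_ofReal
        (Eventually.of_forall fun _ => ENNReal.ofReal_lt_top), ← integral_exp_mul_rampGap ht hx]
    simp only [hreal, smul_eq_mul, mul_comm]

/-- The total mass of a positive measure is the value of its Laplace transform at `0+`. -/
theorem measure_univ_eq_of_laplace {κ : Measure ℝ≥0} {g : ℝ → ℝ} {m : ℝ}
    (hi : ∀ x : ℝ, 0 < x → Integrable (fun s : ℝ≥0 => Real.exp (-(s : ℝ) * x)) κ)
    (hg : ∀ x : ℝ, 0 < x → ∫ s : ℝ≥0, Real.exp (-(s : ℝ) * x) ∂κ = g x)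
    (hm : Tendsto g (𝓝[>] 0) (𝓝 m)) : κ univ = ENNReal.ofReal m := by
  have h1 : Tendsto (fun n : ℕ => ∫⁻ s : ℝ≥0,
      ENNReal.ofReal (Real.exp (-(s : ℝ) * (1 / ((n : ℝ) + 1)))) ∂κ) atTop (𝓝 (∫⁻ _, 1 ∂κ)) := by
    refine lintegral_tendsto_of_tendsto_of_monotone (fun n => by fun_prop)
      (Eventually.of_forall fun s n n' hn => ?_) (Eventually.of_forall fun s => ?_)
    · refine ENNReal.ofReal_le_ofReal (Real.exp_le_exp.2 ?_)
      have : 1 / ((n' : ℝ) + 1) ≤ 1 / ((n : ℝ) + 1) :=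
        one_div_le_one_div_of_le (by positivity) (by gcongr)
      nlinarith [s.coe_nonneg]
    · have hc : Continuous fun x : ℝ => ENNReal.ofReal (Real.exp (-(s : ℝ) * x)) :=
        ENNReal.continuous_ofReal.comp (by fun_prop)
      have := (hc.tendsto 0).comp (tendsto_one_div_add_atTop_nhds_zero_nat (𝕜 := ℝ))
      simpa [Function.comp_def] using this
  have h2 : Tendsto (fun n : ℕ => ∫⁻ s : ℝ≥0,
      ENNReal.ofReal (Real.exp (-(s : ℝ) * (1 / ((n : ℝ) + 1)))) ∂κ) atTop
      (𝓝 (ENNReal.ofReal m)) := by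
    refine (ENNReal.tendsto_ofReal (hm.comp tendsto_one_div_nhdsGT)).congr fun n => ?_
    have hx : (0 : ℝ) < 1 / ((n : ℝ) + 1) := by positivity
    rw [Function.comp_apply, ← hg _ hx, ofReal_integral_eq_lintegral_ofReal (hi _ hx)
      (Eventually.of_forall fun s => (Real.exp_pos _).le)]
  simpa using tendsto_nhds_unique h1 h2

/-! ### Extension to the half-plane -/

theorem norm_exp_neg_mul_le_one (s : ℝ≥0) {z : ℂ} (hz : 0 ≤ z.re) :
    ‖Complex.exp (-((s : ℝ) : ℂ) * z)‖ ≤ 1 := by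
  rw [Complex.norm_exp, Real.exp_le_one_iff, ← Complex.ofReal_neg, Complex.re_ofReal_mul, neg_mul,
    neg_nonpos]
  positivity

/-- The kernel `(1 - e^{-sz}) / s`, with the value `z` at `s = 0`. -/
noncomputable def expKernel (s : ℝ≥0) (z : ℂ) : ℂ :=
  if s = 0 then z else (1 - Complex.exp (-((s : ℝ) : ℂ) * z)) / ((s : ℝ) : ℂ)

theorem expKernel_zero (s : ℝ≥0) : expKernel s 0 = 0 := by simp [expKernel]

theorem hasDerivAt_expKernel (s : ℝ≥0) (z : ℂ) :
    HasDerivAt (expKernel s) (Complex.exp (-((s : ℝ) : ℂ) * z)) z := by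
  by_cases hs : s = 0
  · subst hs
    have e : expKernel 0 = fun z => z := by
      ext z
      simp [expKernel]
    simpa [e] using hasDerivAt_id' z
  · have hs' : ((s : ℝ) : ℂ) ≠ 0 := by exact_mod_cast hs
    have h := ((((hasDerivAt_id' z).const_mul (-((s : ℝ) : ℂ))).cexp.const_sub 1).div_const
      ((s : ℝ) : ℂ))
    have e : expKernel s = fun z => (1 - Complex.exp (-((s : ℝ) : ℂ) * z)) / ((s : ℝ) : ℂ) := by
      ext z
      simp [expKernel, hs]
    rw [e]
    refine h.congr_deriv ?_
    field_simp

theorem norm_expKernel_sub_le (s : ℝ≥0) {z w : ℂ} (hz : 0 ≤ z.re) (hw : 0 ≤ w.re) :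
    ‖expKernel s z - expKernel s w‖ ≤ ‖z - w‖ := by
  have := (convex_halfSpace_re_ge 0).norm_image_sub_le_of_norm_hasDerivWithin_le
    (f := expKernel s) (C := 1) (fun z _ => (hasDerivAt_expKernel s z).hasDerivWithinAt)
    (fun z hz => norm_exp_neg_mul_le_one s hz) (show w ∈ {z : ℂ | 0 ≤ z.re} from hw)
    (show z ∈ {z : ℂ | 0 ≤ z.re} from hz)
  simpa using this

theorem measurable_expKernel (z : ℂ) : Measurable fun s : ℝ≥0 => expKernel s z :=
  Measurable.ite (measurableSet_singleton 0) measurable_const (by fun_prop)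

/-- The primitive of the Laplace transform of `P` that vanishes at `0`. -/
noncomputable def laplacePrimitive (P : Measure ℝ≥0) (z : ℂ) : ℂ := ∫ s, expKernel s z ∂P

section

variable (P : Measure ℝ≥0) [IsProbabilityMeasure P]

theorem integrable_expKernel {z : ℂ} (hz : 0 ≤ z.re) : Integrable (fun s => expKernel s z) P := by
  refine Integrable.of_bound (measurable_expKernel z).aestronglyMeasurable ‖z‖
    (Eventually.of_forall fun s => ?_)
  simpa [expKernel_zero] using norm_expKernel_sub_le s hz (w := 0) le_rfl

theorem norm_laplacePrimitive_sub_le {z w : ℂ} (hz : 0 ≤ z.re) (hw : 0 ≤ w.re) :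
    ‖laplacePrimitive P z - laplacePrimitive P w‖ ≤ ‖z - w‖ := by
  rw [laplacePrimitive, laplacePrimitive,
    ← integral_sub (integrable_expKernel P hz) (integrable_expKernel P hw)]
  have := norm_integral_le_of_norm_le_const (μ := P)
    (Eventually.of_forall fun s => norm_expKernel_sub_le s hz hw)
  simpa using this

theorem continuousOn_laplacePrimitive : ContinuousOn (laplacePrimitive P) {z | 0 ≤ z.re} := by
  refine (LipschitzOnWith.of_dist_le_mul (K := 1) fun z hz w hw => ?_).continuousOn
  simpa [dist_eq_norm] using norm_laplacePrimitive_sub_le P hz hw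

theorem hasDerivAt_laplacePrimitive {z : ℂ} (hz : 0 < z.re) :
    HasDerivAt (laplacePrimitive P) (∫ s : ℝ≥0, Complex.exp (-((s : ℝ) : ℂ) * z) ∂P) z := by
  refine (hasDerivAt_integral_of_dominated_loc_of_deriv_le (F := fun z s => expKernel s z)
    (F' := fun z s => Complex.exp (-((s : ℝ) : ℂ) * z)) (bound := fun _ => 1)
    (s := {z : ℂ | 0 < z.re}) ((isOpen_lt continuous_const Complex.continuous_re).mem_nhds hz)
    (Eventually.of_forall fun z => (measurable_expKernel z).aestronglyMeasurable)
    (integrable_expKernel P hz.le) (by fun_prop)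
    (Eventually.of_forall fun s z hz => norm_exp_neg_mul_le_one s (le_of_lt hz))
    (integrable_const _) (Eventually.of_forall fun s z _ => hasDerivAt_expKernel s z)).2

end

theorem IsBernstein.exists_halfPlaneExtension {φ : ℝ → ℝ} (hφ : IsBernstein φ)
    (h0 : Tendsto φ (𝓝[>] 0) (𝓝 0)) (h1 : Tendsto (deriv φ) (𝓝[>] 0) (𝓝 1)) :
    ∃ ψ : ℂ → ℂ, IsHalfPlaneExtension φ ψ := by
  obtain ⟨P, hP, hlap⟩ := hφ.2.2.exists_laplace h1
  refine ⟨laplacePrimitive P, continuousOn_laplacePrimitive P, fun z hz =>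
    (hasDerivAt_laplacePrimitive P hz).differentiableAt.differentiableWithinAt, ?_⟩
  -- both functions have derivative `φ'` on `(0, ∞)` and limit `0` at `0+`
  have hd : ∀ x ∈ Ioi (0 : ℝ), HasDerivAt (fun x : ℝ => laplacePrimitive P x - φ x) 0 x := by
    intro x hx
    have h2 : HasDerivAt (fun x : ℝ => laplacePrimitive P x)
        (∫ s : ℝ≥0, Complex.exp (-((s : ℝ) : ℂ) * x) ∂P) x :=
      (hasDerivAt_laplacePrimitive P (z := x) (by simpa using hx)).comp_ofReal
    have h3 : (∫ s : ℝ≥0, Complex.exp (-((s : ℝ) : ℂ) * x) ∂P) = ((deriv φ x : ℝ) : ℂ) := by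
      rw [hlap x hx, ← integral_complex_ofReal]
      congr 1
      ext s
      push_cast
      rfl
    have h4 := h2.fun_sub (hφ.differentiableAt hx).hasDerivAt.ofReal_comp
    rwa [h3, sub_self] at h4
  have hconst : ∀ x ∈ Ioi (0 : ℝ), ∀ y ∈ Ioi (0 : ℝ), laplacePrimitive P x - φ x =
      laplacePrimitive P y - φ y := fun x hx y hy =>
    isOpen_Ioi.is_const_of_deriv_eq_zero (f := fun x : ℝ => laplacePrimitive P x - φ x)
      isPreconnected_Ioi (fun x hx => (hd x hx).differentiableAt.differentiableWithinAt)
      (fun x hx => (hd x hx).deriv) hx hy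
  have hlim : Tendsto (fun x : ℝ => laplacePrimitive P x - φ x) (𝓝[>] 0) (𝓝 0) := by
    have hz : laplacePrimitive P 0 = 0 := by simp [laplacePrimitive, expKernel_zero]
    have h2 : Tendsto (fun x : ℝ => laplacePrimitive P x) (𝓝[>] 0) (𝓝 0) := by
      have := (continuousOn_laplacePrimitive P) 0 (by simp)
      rw [ContinuousWithinAt, hz] at this
      refine this.comp (tendsto_nhdsWithin_iff.2 ⟨?_, ?_⟩)
      · exact tendsto_nhdsWithin_of_tendsto_nhds (by
          simpa using Complex.continuous_ofReal.tendsto 0)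
      · filter_upwards [self_mem_nhdsWithin] with x hx
        simpa using le_of_lt (mem_Ioi.1 hx)
    have h3 : Tendsto (fun x : ℝ => (φ x : ℂ)) (𝓝[>] 0) (𝓝 0) := by
      simpa [Function.comp_def] using (Complex.continuous_ofReal.tendsto 0).comp h0
    simpa using h2.sub h3
  intro x hx
  refine sub_eq_zero.1 (tendsto_nhds_unique (tendsto_const_nhds.congr' ?_) hlim)
  filter_upwards [self_mem_nhdsWithin] with y hy using hconst x hx y hy

/-! ### Laplace transforms of positive measures -/

section PositiveMeasure

variable (κ : Measure ℝ≥0) [IsFiniteMeasure κ]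

/-- A finite positive measure, regarded as the complex measure with density `1` with respect to
itself, is its own total variation. -/
theorem variation_withDensityᵥ_one : (κ.withDensityᵥ fun _ => (1 : ℂ)).variation = κ := by
  rw [Measure.variation_withDensityᵥ (integrable_const _)]
  simp

theorem laplaceTransform_withDensityᵥ_one (z : ℂ) :
    laplaceTransform (κ.withDensityᵥ fun _ => (1 : ℂ)) z =
      ∫ s : ℝ≥0, Complex.exp (-((s : ℝ) : ℂ) * z) ∂κ := by
  rw [laplaceTransform, VectorMeasure.integral_eq_setToFun, integral_eq_setToFun]
  simp only [variation_withDensityᵥ_one]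
  apply setToFun_congr_left' _ _ (fun s hs _ => ?_)
  ext
  simp [VectorMeasure.transpose, VectorMeasure.mapRange_apply, weightedSMul,
    withDensityᵥ_apply (integrable_const (1 : ℂ)) hs]

open ProbabilityTheory

theorem neg_mem_interior_integrableExpSet {x : ℝ} (hx : 0 < x) :
    -x ∈ interior (integrableExpSet (fun s : ℝ≥0 => (s : ℝ)) κ) := by
  refine interior_maximal (t := Iio 0) (fun y (hy : y < 0) => ?_) isOpen_Iio (by simpa using hx)
  have := integrable_exp_neg_mul κ (x := -y) (by linarith)
  simpa [integrableExpSet, mul_comm] using this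

theorem differentiableOn_laplace :
    DifferentiableOn ℂ (fun z => ∫ s : ℝ≥0, Complex.exp (-((s : ℝ) : ℂ) * z) ∂κ)
      {z | 0 < z.re} := by
  have h := (differentiableOn_complexMGF (X := fun s : ℝ≥0 => (s : ℝ)) (μ := κ)).comp
    (f := fun z : ℂ => -z) (s := {z | 0 < z.re}) (by fun_prop)
    fun z hz => by simpa using neg_mem_interior_integrableExpSet κ hz
  refine h.congr fun z _ => ?_
  simp [complexMGF, mul_comm]

theorem completelyMonotone_laplace :
    CompletelyMonotone fun x => ∫ s : ℝ≥0, Real.exp (-(s : ℝ) * x) ∂κ := by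
  have e : (fun x => ∫ s : ℝ≥0, Real.exp (-(s : ℝ) * x) ∂κ) =
      fun x => mgf (fun s : ℝ≥0 => (s : ℝ)) κ (-x) := by
    ext x
    simp [mgf, mul_comm]
  rw [e]
  refine ⟨fun x hx => ?_, fun n x hx => ?_⟩
  · have := (analyticAt_mgf (neg_mem_interior_integrableExpSet κ hx)).contDiffAt (n := ∞)
    exact (this.comp x contDiff_neg.contDiffAt).contDiffWithinAt
  · rw [iteratedDeriv_comp_neg, iteratedDeriv_mgf (neg_mem_interior_integrableExpSet κ hx),
      smul_eq_mul, ← mul_assoc, ← mul_pow]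
    simp only [mul_neg, mul_one, neg_neg, one_pow, one_mul]
    exact integral_nonneg fun s => by positivity

end PositiveMeasure

theorem CompletelyMonotone.congr {f g : ℝ → ℝ} (hf : CompletelyMonotone f)
    (h : ∀ x : ℝ, 0 < x → g x = f x) : CompletelyMonotone g := by
  refine ⟨hf.1.congr h, fun n x hx => ?_⟩
  have : g =ᶠ[𝓝 x] f := by filter_upwards [Ioi_mem_nhds hx] with y hy using h y hy
  rw [this.iteratedDeriv_eq]
  exact hf.2 n x hx

/-- Two holomorphic functions on the right half-plane that agree on `(0, ∞)` are equal. -/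
theorem eq_of_eq_on_pos {F G : ℂ → ℂ} (hF : DifferentiableOn ℂ F {z | 0 < z.re})
    (hG : DifferentiableOn ℂ G {z | 0 < z.re}) (h : ∀ x : ℝ, 0 < x → F x = G x) :
    ∀ z : ℂ, 0 < z.re → F z = G z := by
  have hU : IsOpen {z : ℂ | 0 < z.re} := isOpen_lt continuous_const Complex.continuous_re
  refine (hF.analyticOnNhd hU).eqOn_of_preconnected_of_frequently_eq (hG.analyticOnNhd hU)
    (convex_halfSpace_re_gt 0).isPreconnected (z₀ := 1) (by simp) ?_
  have ht : Tendsto (fun x : ℝ => (x : ℂ)) (𝓝[>] 1) (𝓝[≠] 1) := by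
    refine tendsto_nhdsWithin_iff.2 ⟨tendsto_nhdsWithin_of_tendsto_nhds
      (by simpa using Complex.continuous_ofReal.tendsto 1), ?_⟩
    filter_upwards [self_mem_nhdsWithin] with x hx
    simpa using ne_of_gt (mem_Ioi.1 hx)
  refine ht.frequently (Eventually.frequently ?_)
  filter_upwards [self_mem_nhdsWithin] with x hx using h x (one_pos.trans hx)

/-- The positive measure whose Laplace transform is `x^{-2} (e^{-tφ(x)} - e^{-tx})`. -/
theorem IsBernstein.exists_laplace_exp_sub_exp {φ : ℝ → ℝ} (hφ : IsBernstein φ)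
    (h0 : Tendsto φ (𝓝[>] 0) (𝓝 0)) (h1 : Tendsto (deriv φ) (𝓝[>] 0) (𝓝 1)) {c : ℝ}
    (hc : Tendsto (iteratedDeriv 2 φ) (𝓝[>] 0) (𝓝 c)) {t : ℝ} (ht : 0 ≤ t) :
    ∃ κ : Measure ℝ≥0, κ univ = ENNReal.ofReal (t / 2 * |c|) ∧ ∀ x : ℝ, 0 < x →
      x ^ (-2 : ℤ) * (Real.exp (-t * φ x) - Real.exp (-t * x)) =
        ∫ s : ℝ≥0, Real.exp (-(s : ℝ) * x) ∂κ := by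
  have hE : Tendsto (fun x => Real.exp (-t * φ x)) (𝓝[>] 0) (𝓝 1) := by
    simpa [Function.comp_def] using (Real.continuous_exp.tendsto _).comp (h0.const_mul (-t))
  obtain ⟨P, hP, hlap⟩ := (hφ.completelyMonotone_exp ht).exists_laplace hE
  have hmean : ∫⁻ s : ℝ≥0, s ∂P ≤ ENNReal.ofReal t := by
    refine lintegral_coe_le_of_laplace fun x hx => ?_
    rw [← hlap x hx]
    have h2 := Real.add_one_le_exp (-t * φ x)
    have h3 := mul_le_mul_of_nonneg_left (hφ.le_self h0 h1 hx) ht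
    linarith
  obtain ⟨κ, hκ⟩ := exists_laplace_sub_exp_div_sq ht hmean
  have hg : ∀ x : ℝ, 0 < x → ∫ s : ℝ≥0, Real.exp (-(s : ℝ) * x) ∂κ =
      (Real.exp (-t * φ x) - Real.exp (-t * x)) / x ^ 2 := fun x hx => by
    rw [(hκ x hx).2, ← hlap x hx]
  refine ⟨κ, ?_, fun x hx => ?_⟩
  · rw [abs_of_nonpos (hφ.second_deriv_limit_nonpos hc)]
    exact measure_univ_eq_of_laplace (fun x hx => (hκ x hx).1) hg
      (tendsto_exp_sub_exp_div_sq hφ h0 h1 hc t)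
  · rw [hg x hx, zpow_neg, zpow_ofNat, div_eq_inv_mul]

end HillePhillips

open HillePhillips
theorem proposition4p4 (φ : ℝ → ℝ) (hφ : φ ∈ Phi) (c : ℝ)
    (hc : Tendsto (iteratedDeriv 2 φ) (𝓝[>] 0) (𝓝 c)) :
    (∃ ψ : ℂ → ℂ, IsHalfPlaneExtension φ ψ) ∧
    ∀ ψ : ℂ → ℂ, IsHalfPlaneExtension φ ψ → ∀ t : ℝ, 0 < t →
      CompletelyMonotone
        (fun x : ℝ => x ^ (-2 : ℤ) * (Real.exp (-t * φ x) - Real.exp (-t * x))) ∧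
      MemA1Plus
        (fun z : ℂ => z ^ (-2 : ℤ) * (Complex.exp (-t * ψ z) - Complex.exp (-t * z))) ∧
      normA1Plus
        (fun z : ℂ => z ^ (-2 : ℤ) * (Complex.exp (-t * ψ z) - Complex.exp (-t * z))) =
        t / 2 * |c| := by
  obtain ⟨hB, h0, h1, -⟩ := hφ
  refine ⟨hB.exists_halfPlaneExtension h0 h1, fun ψ hψ t ht => ?_⟩
  obtain ⟨κ, hκ, hlap⟩ := hB.exists_laplace_exp_sub_exp h0 h1 hc ht.le
  have hfin : IsFiniteMeasure κ := ⟨by rw [hκ]; exact ENNReal.ofReal_lt_top⟩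
  have hF : ∀ z : ℂ, 0 < z.re →
      z ^ (-2 : ℤ) * (Complex.exp (-t * ψ z) - Complex.exp (-t * z)) =
        laplaceTransform (κ.withDensityᵥ fun _ => (1 : ℂ)) z := by
    simp only [laplaceTransform_withDensityᵥ_one]
    refine eq_of_eq_on_pos ?_ (differentiableOn_laplace κ) fun x hx => ?_
    · refine DifferentiableOn.mul (fun z hz => ?_) ?_
      · have hz0 : z ≠ 0 := fun h => by simp [h] at hz
        exact (differentiableAt_zpow.2 (Or.inl hz0)).differentiableWithinAt
      · exact ((hψ.2.1.const_mul _).cexp).sub (by fun_prop)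
    · rw [hψ.2.2 x hx]
      have := congrArg (fun r : ℝ => (r : ℂ)) (hlap x hx)
      simp only [← integral_complex_ofReal] at this
      push_cast at this
      exact this
  refine ⟨(completelyMonotone_laplace κ).congr hlap, ⟨_, hF⟩, ?_⟩
  rw [normA1Plus_eq hF, variation_withDensityᵥ_one, Measure.real, hκ,
    ENNReal.toReal_ofReal (by positivity)]
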